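/- Let $\alpha\in[-\infty,+\infty)$ and let $\varphi:\,]\alpha,+\infty[\,\to\mathbb{R}$ be a smooth function with $\dot\varphi>0$ and $\ddot\varphi\ge 0$ on $]\alpha,+\infty[$. Let $\Sigma$ be a smooth surface without boundary (Hausdorff and second countable) and let $f:\Sigma\to\mathbb{R}^3$ be a smooth immersion with $f(\Sigma)\subset\{x\in\mathbb{R}^3:\langle x,e_3\rangle>\alpha\}$, oriented by a smooth unit normal field $N:\Sigma\to\mathbb{R}^3$. Equip $\Sigma$ with the induced metric, its area element $d\Sigma$ and gradient $\nabla$. Let $\mathcal S(v,w)=\langle D_vN,df(w)\rangle$ be the second fundamental form, $H$ its trace with respect to the induced metric (the sum of the principal curvatures), $K$ the Gauss curvature, $|\mathcal S|^2=H^2-2K$, and put $\mu=\langle f,e_3\rangle$, $\eta=\langle N,e_3\rangle$. Suppose that $f$ is $[\varphi,e_3]$-minimal, i.e. $H=-\langle\overline\nabla\varphi,N\rangle=-\dot\varphi(\mu)\,\eta$ on $\Sigma$, where $\overline\nabla\varphi$ is the gradient in $\mathbb{R}^3$ of $x\mapsto\varphi(\langle x,e_3\rangle)$, and that $H\le 0$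 on $\Sigma$. Then $f$ is stable: for every compactly supported smooth function $u:\Sigma\to\mathbb{R}$ the integral $$\mathcal Q_\varphi(u,u)=\int_\Sigma e^{\varphi(\mu)}\Big(|\nabla u|^2-\big(|\mathcal S|^2-\ddot\varphi(\mu)\,\eta^2\big)u^2\Big)\,d\Sigma$$ converges and satisfies $\mathcal Q_\varphi(u,u)\ge 0$. -/

import Mathlib

open scoped Manifold ContDiff RealInnerProductSpace

noncomputable section

namespace PhiMinimal

/-- The Euclidean plane, the model space of surfaces. -/
abbrev E2 : Type := EuclideanSpace ℝ (Fin 2)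

/-- Euclidean three-space. -/
abbrev E3 : Type := EuclideanSpace ℝ (Fin 3)

/-- The vertical unit vector `e₃` (coordinates are indexed by `0, 1, 2`). -/
def e3 : E3 := EuclideanSpace.single 2 1

/-- The part `ℝ³_α = {x : ⟨x, e₃⟩ > α}` of three-space; `α = ⊥` stands for `α = -∞`. -/
def upperRegion (α : WithBot ℝ) : Set E3 := {x | α < ((⟪x, e3⟫ : ℝ) : WithBot ℝ)}

section Surface

variable {M : Type*} [TopologicalSpace M] [ChartedSpace E2 M]

/-- The differential `df_p : T_pM → ℝ³` of a map `f : M → ℝ³`. -/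
def diff (f : M → E3) (p : M) : TangentSpace (𝓡 2) p →L[ℝ] E3 :=
  mfderiv (𝓡 2) (𝓡 3) f p

/-- The differential `du_p : T_pM → ℝ` of a function `u : M → ℝ`. -/
def diffFun (u : M → ℝ) (p : M) : TangentSpace (𝓡 2) p →L[ℝ] ℝ :=
  mfderiv (𝓡 2) 𝓘(ℝ, ℝ) u p

/-- The standard basis of `T_pM`, which is the coordinate basis `∂₁, ∂₂` of the preferred
chart at `p`. -/
def tangentBasis (p : M) : Module.Basis (Fin 2) ℝ (TangentSpace (𝓡 2) p) :=
  (EuclideanSpace.basisFun (Fin 2) ℝ).toBasis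

/-- `f : M → ℝ³` is a smooth immersion oriented by the smooth unit normal field
(Gauss map) `N`. -/
structure IsOrientedImmersion (f N : M → E3) : Prop where
  smooth : ContMDiff (𝓡 2) (𝓡 3) ∞ f
  injective_diff : ∀ p, Function.Injective (diff f p)
  smooth_normal : ContMDiff (𝓡 2) (𝓡 3) ∞ N
  norm_normal : ∀ p, ‖N p‖ = 1
  inner_normal : ∀ p (v : TangentSpace (𝓡 2) p), ⟪diff f p v, N p⟫ = 0

/-- The metric induced by `f` (first fundamental form). -/
def metric (f : M → E3) (p : M) (v w : TangentSpace (𝓡 2) p) : ℝ :=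
  ⟪diff f p v, diff f p w⟫

/-- The second fundamental form `𝒮(v, w) = ⟨D_v N, w⟩`. With this sign the unit sphere has
`𝒮 = metric` for the outer normal. -/
def secondForm (f N : M → E3) (p : M) (v w : TangentSpace (𝓡 2) p) : ℝ :=
  ⟪diff N p v, diff f p w⟫

/-- The matrix `(g_ij)` of the induced metric. -/
def metricMatrix (f : M → E3) (p : M) : Matrix (Fin 2) (Fin 2) ℝ :=
  Matrix.of fun i j => metric f p (tangentBasis p i) (tangentBasis p j)

/-- The matrix `(h_ij)` of the second fundamental form. -/
def secondFormMatrix (f N : M → E3) (p : M) : Matrix (Fin 2) (Fin 2) ℝ :=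
  Matrix.of fun i j => secondForm f N p (tangentBasis p i) (tangentBasis p j)

/-- The matrix `g⁻¹ h` of the endomorphism of `T_pM` that represents `𝒮` with respect to the
induced metric; its eigenvalues are the principal curvatures. -/
def shapeMatrix (f N : M → E3) (p : M) : Matrix (Fin 2) (Fin 2) ℝ :=
  (metricMatrix f p)⁻¹ * secondFormMatrix f N p

/-- The mean curvature `H = k₁ + k₂`, the trace of `𝒮` with respect to the metric. -/
def meanCurvature (f N : M → E3) (p : M) : ℝ := (shapeMatrix f N p).trace

/-- The Gauss curvature `K = k₁ k₂`. -/
def gaussCurvature (f N : M → E3) (p : M) : ℝ := (shapeMatrix f N p).det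

/-- The squared length `|𝒮|² = H² - 2K = k₁² + k₂²` of the second fundamental form. -/
def normSqSecondForm (f N : M → E3) (p : M) : ℝ :=
  meanCurvature f N p ^ 2 - 2 * gaussCurvature f N p

/-- The gradient `∇u` on `M` for the induced metric: `(∇u)ⁱ = g^{ij} ∂_j u`. -/
def surfaceGradient (f : M → E3) (u : M → ℝ) (p : M) : TangentSpace (𝓡 2) p :=
  ∑ i, ((metricMatrix f p)⁻¹.mulVec fun j => diffFun u p (tangentBasis p j)) i •
    tangentBasis p i

/-- The height function `μ = ⟨p, e₃⟩`. -/
def height (f : M → E3) (p : M) : ℝ := ⟪f p, e3⟫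

/-- The angle function `η = ⟨N, e₃⟩`. -/
def angle (N : M → E3) (p : M) : ℝ := ⟪N p, e3⟫

/-- The oriented immersion `(f, N)` is `[φ, e₃]`-minimal: `H = -⟨∇̄φ, N⟩`, where `∇̄φ` is the
gradient in `ℝ³` of `x ↦ φ ⟨x, e₃⟩`. -/
def IsPhiMinimal (φ : ℝ → ℝ) (f N : M → E3) : Prop :=
  ∀ p, meanCurvature f N p = -⟪gradient (fun x : E3 => φ ⟪x, e3⟫) (f p), N p⟫

/-- The area density `√det(⟨∂_i F, ∂_j F⟩)` of the local parametrization `F = f ∘ e⁻¹` given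
by a chart `e`. -/
def areaDensity (f : M → E3) (e : OpenPartialHomeomorph M E2) (y : E2) : ℝ :=
  Real.sqrt (Matrix.of fun i j : Fin 2 =>
    ⟪fderiv ℝ (f ∘ e.symm) y (EuclideanSpace.single i 1),
      fderiv ℝ (f ∘ e.symm) y (EuclideanSpace.single j 1)⟫).det

/-- The area measure on the domain of the chart `e`, extended by zero to `M`:
`s ↦ ∫_{e(s)} √det(g_ij) dy`. -/
def chartArea [MeasurableSpace M] (f : M → E3) (e : OpenPartialHomeomorph M E2) :
    MeasureTheory.Measure M :=
  ((MeasureTheory.volume.restrict e.target).withDensity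
    fun y => ENNReal.ofReal (areaDensity f e y)).map e.symm

/-- The area measure `dΣ` of the immersion `f`: the least measure that dominates all the
measures `chartArea f e`. As these agree on overlaps of charts, it is the measure whose
restriction to each chart domain is the measure with density `√det(g_ij)`. -/
def area [MeasurableSpace M] (f : M → E3) : MeasureTheory.Measure M :=
  ⨆ e ∈ atlas E2 M, chartArea f e

/-- The integrand of the stability form `Q_φ(u, v)`. -/
def stabilityIntegrand (φ : ℝ → ℝ) (f N : M → E3) (u v : M → ℝ) (p : M) : ℝ :=
  Real.exp (φ (height f p)) *
    (metric f p (surfaceGradient f u p) (surfaceGradient f v p) -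
      (normSqSecondForm f N p - deriv (deriv φ) (height f p) * angle N p ^ 2) * (u p * v p))

/-- The stability form
`Q_φ(u, v) = ∫ e^φ (⟨∇u, ∇v⟩ - (|𝒮|² - φ'' η²) u v) dΣ`. -/
def stabilityForm [MeasurableSpace M] (φ : ℝ → ℝ) (f N : M → E3) (u v : M → ℝ) : ℝ :=
  ∫ p, stabilityIntegrand φ f N u v p ∂(area f)

/-- Stability: for every compactly supported smooth `u` the integral `Q_φ(u, u)` converges and
is nonnegative. -/
def IsStable [MeasurableSpace M] (φ : ℝ → ℝ) (f N : M → E3) : Prop :=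
  ∀ u : M → ℝ, ContMDiff (𝓡 2) 𝓘(ℝ, ℝ) ∞ u → HasCompactSupport u →
    MeasureTheory.Integrable (stabilityIntegrand φ f N u u) (area f) ∧
      0 ≤ stabilityForm φ f N u u

end Surface

end PhiMinimal

end

/-!
On a surface in `ℝ³` the one-form `X ↦ dN(J X)`, where `J` is the rotation by a right angle in the
tangent plane, equals `H (N × df) - N × dN`. Its exterior derivative is an algebraic expression in
the first derivatives of `f`, `N` and `H`, which gives the weak form of
`ΔN = df(∇H) - |𝒮|² N`: the field `div(w ∇N)` has integral zero for compactly supported `w`.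

For a `[φ, e₃]`-minimal surface the vertical component, with `w = e^φ ψ`, says that the angle
function `η` solves `div(e^φ ∇η) + e^φ (|𝒮|² + φ'' |∇μ|²) η = 0` weakly. Since `H = -φ' η ≤ 0`, the
solution `η` is nonnegative, and testing with `ψ = u² / (η + ε)` yields
`Q(u, u) ≥ -∫ e^φ |𝒮|² u² ε / (η + ε)`. The right-hand side tends to `0` as `ε → 0`: where `η`
vanishes it is minimal, so `dη = 0` and `H = 0`, hence `dN` has rank at most one and `|𝒮|² = 0`.
-/

noncomputable section

namespace PhiMinimal

section PlaneAlgebra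

variable {R V W : Type*} [CommRing R] [AddCommGroup V] [Module R V] [AddCommGroup W] [Module R W]
  {B : V →ₗ[R] V →ₗ[R] W}

theorem isAlt_apply_eq_smul (hB : B.IsAlt) (b : Module.Basis (Fin 2) R V) (v w : V) :
    B v w = (b.repr v 0 * b.repr w 1 - b.repr v 1 * b.repr w 0) • B (b 0) (b 1) := by
  conv_lhs => rw [← b.sum_repr v, ← b.sum_repr w]
  simp only [Fin.sum_univ_two, map_add, map_smul, LinearMap.add_apply, LinearMap.smul_apply,
    hB (b 0), hB (b 1), ← hB.neg (b 0) (b 1)]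
  module

theorem isAlt_apply_map_add_apply_map (hB : B.IsAlt) (b : Module.Basis (Fin 2) R V)
    (A : V →ₗ[R] V) (v w : V) :
    B (A v) w + B v (A w) = LinearMap.trace R V A • B v w := by
  rw [LinearMap.trace_eq_matrix_trace R b, Matrix.trace_fin_two, isAlt_apply_eq_smul hB b (A v),
    isAlt_apply_eq_smul hB b v (A w), isAlt_apply_eq_smul hB b v w]
  simp only [← LinearMap.toMatrix_mulVec_repr b b A, Matrix.mulVec, dotProduct, Fin.sum_univ_two]
  module

theorem isAlt_apply_map_map (hB : B.IsAlt) (b : Module.Basis (Fin 2) R V)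
    (A : V →ₗ[R] V) (v w : V) : B (A v) (A w) = LinearMap.det A • B v w := by
  rw [← LinearMap.det_toMatrix b, Matrix.det_fin_two, isAlt_apply_eq_smul hB b (A v),
    isAlt_apply_eq_smul hB b v]
  simp only [← LinearMap.toMatrix_mulVec_repr b b A, Matrix.mulVec, dotProduct, Fin.sum_univ_two]
  module

theorem isAlt_smul_cyclic_sum (hB : B.IsAlt) (b : Module.Basis (Fin 2) R V) (a : V →ₗ[R] R)
    (u v w : V) : a u • B v w + a v • B w u + a w • B u v = 0 := by
  have ha (x : V) : a x = b.repr x 0 * a (b 0) + b.repr x 1 * a (b 1) := by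
    conv_lhs => rw [← b.sum_repr x]
    simp only [Fin.sum_univ_two, map_add, map_smul, smul_eq_mul]
  rw [isAlt_apply_eq_smul hB b v, isAlt_apply_eq_smul hB b w, isAlt_apply_eq_smul hB b u,
    ha u, ha v, ha w]
  module

end PlaneAlgebra

section Cross

/-- The cross product of `ℝ³` as a continuous bilinear map, the form in which it can be
differentiated. -/
def cross : E3 →L[ℝ] E3 →L[ℝ] E3 :=
  LinearMap.toContinuousBilinearMap <|
    (crossProduct.compl₁₂ (WithLp.linearEquiv 2 ℝ (Fin 3 → ℝ)).toLinearMap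
      (WithLp.linearEquiv 2 ℝ (Fin 3 → ℝ)).toLinearMap).compr₂
      (WithLp.linearEquiv 2 ℝ (Fin 3 → ℝ)).symm.toLinearMap

variable {n x y : E3}

theorem ofLp_cross (x y : E3) : (cross x y).ofLp = crossProduct x.ofLp y.ofLp := rfl

theorem inner_eq_dotProduct (x y : E3) : ⟪x, y⟫ = x.ofLp ⬝ᵥ y.ofLp := by
  rw [EuclideanSpace.inner_eq_star_dotProduct, star_trivial, dotProduct_comm]

theorem cross_self (x : E3) : cross x x = 0 :=
  WithLp.ofLp_injective 2 (_root_.cross_self x.ofLp)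

theorem neg_cross (x y : E3) : -cross x y = cross y x :=
  WithLp.ofLp_injective 2 (cross_anticomm x.ofLp y.ofLp)

theorem inner_cross_rotate (x y z : E3) : ⟪cross x y, z⟫ = ⟪cross y z, x⟫ := by
  simp only [inner_eq_dotProduct, ofLp_cross]
  rw [dotProduct_comm, triple_product_permutation, dotProduct_comm]

theorem inner_cross_left_self (x y : E3) : ⟪cross x y, x⟫ = 0 := by
  rw [inner_eq_dotProduct, ofLp_cross, dotProduct_comm, dot_self_cross]

theorem inner_cross_cross (x y z w : E3) :
    ⟪cross x y, cross z w⟫ = ⟪x, z⟫ * ⟪y, w⟫ - ⟪x, w⟫ * ⟪y, z⟫ := by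
  simp only [inner_eq_dotProduct, ofLp_cross, cross_dot_cross]

theorem norm_cross_sq (x y : E3) : ‖cross x y‖ ^ 2 = (Matrix.gram ℝ ![x, y]).det := by
  rw [← real_inner_self_eq_norm_sq, inner_cross_cross, Matrix.det_fin_two]
  rfl

theorem cross_cross_eq (x y z : E3) : cross x (cross y z) = ⟪x, z⟫ • y - ⟪y, x⟫ • z := by
  simp only [inner_eq_dotProduct]
  exact WithLp.ofLp_injective 2 (cross_cross_eq_smul_sub_smul' x.ofLp y.ofLp z.ofLp)

theorem cross_eq_inner_smul (hn : ‖n‖ = 1) (hx : ⟪x, n⟫ = 0) (hy : ⟪y, n⟫ = 0) :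
    cross x y = ⟪cross x y, n⟫ • n := by
  have hparallel : cross n (cross x y) = 0 := by
    rw [cross_cross_eq, hx, real_inner_comm, hy, zero_smul, zero_smul, sub_zero]
  have hdouble := cross_cross_eq n n (cross x y)
  rw [hparallel, map_zero, real_inner_self_eq_norm_sq, hn, real_inner_comm, one_pow, one_smul]
    at hdouble
  exact (sub_eq_zero.1 hdouble.symm).symm

end Cross

section Differential

variable {M : Type*} [TopologicalSpace M] [ChartedSpace E2 M] {p : M}

theorem mfderiv_comp_left_apply {E F : Type*} [NormedAddCommGroup E] [NormedSpace ℝ E]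
    [NormedAddCommGroup F] [NormedSpace ℝ F] {G : E → F} {h : M → E}
    (hG : DifferentiableAt ℝ G (h p)) (hh : MDifferentiableAt (𝓡 2) 𝓘(ℝ, E) h p)
    (v : TangentSpace (𝓡 2) p) :
    mfderiv (𝓡 2) 𝓘(ℝ, F) (G ∘ h) p v = fderiv ℝ G (h p) (mfderiv (𝓡 2) 𝓘(ℝ, E) h p v) := by
  rw [mfderiv_comp_apply p hG.mdifferentiableAt hh, mfderiv_eq_fderiv]
  rfl

theorem diffFun_comp {χ : ℝ → ℝ} {u : M → ℝ} (hχ : DifferentiableAt ℝ χ (u p))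
    (hu : MDifferentiableAt (𝓡 2) 𝓘(ℝ, ℝ) u p) (v : TangentSpace (𝓡 2) p) :
    diffFun (fun q => χ (u q)) p v = deriv χ (u p) * diffFun u p v :=
  (mfderiv_comp_left_apply hχ hu v).trans (fderiv_eq_deriv_mul (y := diffFun u p v))

theorem diffFun_mul {u w : M → ℝ} (hu : MDifferentiableAt (𝓡 2) 𝓘(ℝ, ℝ) u p)
    (hw : MDifferentiableAt (𝓡 2) 𝓘(ℝ, ℝ) w p) (v : TangentSpace (𝓡 2) p) :
    diffFun (fun q => u q * w q) p v = u p * diffFun w p v + w p * diffFun u p v :=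
  DFunLike.congr_fun (hu.hasMFDerivAt.mul hw.hasMFDerivAt).mfderiv v

theorem diffFun_inner_const {g : M → E3} (hg : MDifferentiableAt (𝓡 2) (𝓡 3) g p) (c : E3)
    (v : TangentSpace (𝓡 2) p) : diffFun (fun q => ⟪g q, c⟫) p v = ⟪diff g p v, c⟫ := by
  have hlinear : (fun x : E3 => ⟪x, c⟫) = innerSL ℝ c := funext fun x => real_inner_comm c x
  have hchain := mfderiv_comp_left_apply (innerSL ℝ c).differentiableAt hg v
  rw [(innerSL ℝ c).fderiv, ← hlinear] at hchain
  exact hchain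

theorem inner_diff_self_of_norm_eq_one {N : M → E3} (hN : MDifferentiableAt (𝓡 2) (𝓡 3) N p)
    (hnorm : ∀ q, ‖N q‖ = 1) (v : TangentSpace (𝓡 2) p) : ⟪diff N p v, N p⟫ = 0 := by
  have hsq : HasFDerivAt (fun x : E3 => ‖x‖ ^ 2) (2 • innerSL ℝ (N p)) (N p) :=
    (hasStrictFDerivAt_norm_sq (N p)).hasFDerivAt
  have hconst : (fun x : E3 => ‖x‖ ^ 2) ∘ N = fun _ => (1 : ℝ) := by
    funext q
    simp only [Function.comp_apply, hnorm, one_pow]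
  have hchain := mfderiv_comp_left_apply hsq.differentiableAt hN v
  rw [hconst, mfderiv_const, hsq.fderiv] at hchain
  have : 0 = 2 • ⟪N p, diff N p v⟫ := hchain
  rw [real_inner_comm]
  simpa using this.symm

theorem diffFun_add {u w : M → ℝ} (hu : MDifferentiableAt (𝓡 2) 𝓘(ℝ, ℝ) u p)
    (hw : MDifferentiableAt (𝓡 2) 𝓘(ℝ, ℝ) w p) (v : TangentSpace (𝓡 2) p) :
    diffFun (u + w) p v = diffFun u p v + diffFun w p v :=
  DFunLike.congr_fun (hu.hasMFDerivAt.add hw.hasMFDerivAt).mfderiv v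

theorem surfaceGradient_add (f : M → E3) {u w : M → ℝ}
    (hu : MDifferentiableAt (𝓡 2) 𝓘(ℝ, ℝ) u p) (hw : MDifferentiableAt (𝓡 2) 𝓘(ℝ, ℝ) w p) :
    surfaceGradient f (u + w) p = surfaceGradient f u p + surfaceGradient f w p := by
  have hcoord : (fun j => diffFun (u + w) p (tangentBasis p j)) =
      (fun j => diffFun u p (tangentBasis p j)) + fun j => diffFun w p (tangentBasis p j) :=
    funext fun j => diffFun_add hu hw _
  simp only [surfaceGradient, hcoord, Matrix.mulVec_add, Pi.add_apply, add_smul,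
    Finset.sum_add_distrib]

theorem surfaceGradient_eq_zero {f : M → E3} {u : M → ℝ} (hu : diffFun u p = 0) :
    surfaceGradient f u p = 0 := by
  have hcoord : (fun j => diffFun u p (tangentBasis p j)) = 0 := by
    rw [hu]
    rfl
  simp only [surfaceGradient, hcoord, Matrix.mulVec_zero, Pi.zero_apply, zero_smul,
    Finset.sum_const_zero]

end Differential

section TangentPlane

variable {M : Type*} [TopologicalSpace M] [ChartedSpace E2 M] {f N : M → E3}

/-- The area form `⟨df v × df w, N⟩` of the oriented surface `(f, N)`. -/
def areaForm (f N : M → E3) (p : M) (v w : TangentSpace (𝓡 2) p) : ℝ :=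
  ⟪cross (diff f p v) (diff f p w), N p⟫

/-- The vector product `(v, w) ↦ df v × df w` of tangent vectors, as a bilinear map. -/
def tangentCross (f : M → E3) (p : M) :
    TangentSpace (𝓡 2) p →ₗ[ℝ] TangentSpace (𝓡 2) p →ₗ[ℝ] E3 :=
  cross.toLinearMap₁₂.compl₁₂ (diff f p).toLinearMap (diff f p).toLinearMap

/-- The one-form `H N × df - N × dN` with values in `ℝ³`. It is `dN ∘ J`, where `J` is the rotation
of the tangent plane by a right angle, `df (J v) = N × df v`. -/
def rotatedDiffNormal (f N : M → E3) (p : M) (v : TangentSpace (𝓡 2) p) : E3 :=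
  meanCurvature f N p • cross (N p) (diff f p v) - cross (N p) (diff N p v)

theorem tangentCross_isAlt (f : M → E3) (p : M) : (tangentCross f p).IsAlt :=
  fun v => cross_self (diff f p v)

theorem metricMatrix_eq_gram (f : M → E3) (p : M) :
    metricMatrix f p = Matrix.gram ℝ fun i => diff f p (tangentBasis p i) := rfl

namespace IsOrientedImmersion

variable (hf : IsOrientedImmersion f N) (p : M)
include hf

theorem inner_diff_normal (v : TangentSpace (𝓡 2) p) : ⟪diff N p v, N p⟫ = 0 :=
  inner_diff_self_of_norm_eq_one (hf.smooth_normal.mdifferentiableAt (by simp)) hf.norm_normal v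

theorem cross_diff_eq (v w : TangentSpace (𝓡 2) p) :
    cross (diff f p v) (diff f p w) = areaForm f N p v w • N p :=
  cross_eq_inner_smul (hf.norm_normal p) (hf.inner_normal p v) (hf.inner_normal p w)

theorem areaForm_ne_zero {v w : TangentSpace (𝓡 2) p} (h : LinearIndependent ℝ ![v, w]) :
    areaForm f N p v w ≠ 0 := by
  have hmap : LinearIndependent ℝ ![diff f p v, diff f p w] := by
    have := h.map' (diff f p).toLinearMap (LinearMap.ker_eq_bot.2 (hf.injective_diff p))
    rwa [← FinVec.map_eq] at this
  intro hzero
  have hdet := norm_cross_sq (diff f p v) (diff f p w)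
  rw [hf.cross_diff_eq, hzero, zero_smul, norm_zero, sq, zero_mul] at hdet
  exact Matrix.det_gram_ne_zero_iff_linearIndependent.2 hmap hdet.symm

theorem range_diff : LinearMap.range (diff f p).toLinearMap = (ℝ ∙ N p)ᗮ := by
  have hN : N p ≠ 0 := norm_ne_zero_iff.1 (by rw [hf.norm_normal]; exact one_ne_zero)
  have : Fact (Module.finrank ℝ E3 = 2 + 1) := ⟨finrank_euclideanSpace_fin⟩
  apply Submodule.eq_of_le_of_finrank_eq
  · rintro _ ⟨v, rfl⟩
    exact Submodule.mem_orthogonal_singleton_iff_inner_left.2 (hf.inner_normal p v)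
  · rw [LinearMap.finrank_range_of_inj (hf.injective_diff p),
      Submodule.finrank_orthogonal_span_singleton (n := 2) hN,
      Module.finrank_eq_card_basis (tangentBasis p), Fintype.card_fin]

theorem eq_of_inner_diff_eq {X Y : E3} (hX : ⟪X, N p⟫ = 0) (hY : ⟪Y, N p⟫ = 0)
    (h : ∀ v : TangentSpace (𝓡 2) p, ⟪X, diff f p v⟫ = ⟪Y, diff f p v⟫) : X = Y := by
  have hmem : X - Y ∈ LinearMap.range (diff f p).toLinearMap := by
    rw [hf.range_diff, Submodule.mem_orthogonal_singleton_iff_inner_left, inner_sub_left, hX, hY,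
      sub_zero]
  obtain ⟨v, hv⟩ := hmem
  rw [← sub_eq_zero, ← inner_self_eq_zero (𝕜 := ℝ)]
  nth_rw 2 [← hv]
  rw [inner_sub_left, sub_eq_zero]
  exact h v

theorem exists_weingarten : ∃ A : TangentSpace (𝓡 2) p →ₗ[ℝ] TangentSpace (𝓡 2) p,
    ∀ v, diff f p (A v) = diff N p v := by
  have hrange (v : TangentSpace (𝓡 2) p) :
      (diff N p).toLinearMap v ∈ LinearMap.range (diff f p).toLinearMap := by
    rw [hf.range_diff]
    exact Submodule.mem_orthogonal_singleton_iff_inner_left.2 (hf.inner_diff_normal p v)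
  let D := LinearEquiv.ofInjective (diff f p).toLinearMap (hf.injective_diff p)
  refine ⟨D.symm.toLinearMap ∘ₗ (diff N p).toLinearMap.codRestrict _ hrange, fun v => ?_⟩
  exact congrArg Subtype.val (D.apply_symm_apply ⟨diff N p v, hrange v⟩)

theorem isUnit_det_metricMatrix : IsUnit (metricMatrix f p).det := by
  rw [isUnit_iff_ne_zero, metricMatrix_eq_gram, Matrix.det_gram_ne_zero_iff_linearIndependent]
  exact (tangentBasis p).linearIndependent.map' (diff f p).toLinearMap
    (LinearMap.ker_eq_bot.2 (hf.injective_diff p))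

omit hf in
theorem secondFormMatrix_eq {A : TangentSpace (𝓡 2) p →ₗ[ℝ] TangentSpace (𝓡 2) p}
    (hA : ∀ v, diff f p (A v) = diff N p v) : secondFormMatrix f N p =
      (LinearMap.toMatrix (tangentBasis p) (tangentBasis p) A).transpose * metricMatrix f p := by
  ext i j
  have hsum := (tangentBasis p).sum_repr (A (tangentBasis p i))
  simp only [secondFormMatrix, secondForm, metricMatrix, metric, Matrix.mul_apply,
    Matrix.transpose_apply, Matrix.of_apply, LinearMap.toMatrix_apply, ← hA]
  conv_lhs => rw [← hsum]
  rw [map_sum, sum_inner]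
  simp only [map_smul, real_inner_smul_left]

theorem meanCurvature_eq_trace {A : TangentSpace (𝓡 2) p →ₗ[ℝ] TangentSpace (𝓡 2) p}
    (hA : ∀ v, diff f p (A v) = diff N p v) : meanCurvature f N p = LinearMap.trace ℝ _ A := by
  rw [meanCurvature, shapeMatrix, secondFormMatrix_eq p hA, Matrix.trace_mul_comm,
    Matrix.mul_nonsing_inv_cancel_right _ _ (hf.isUnit_det_metricMatrix p), Matrix.trace_transpose,
    LinearMap.trace_eq_matrix_trace ℝ (tangentBasis p)]

theorem gaussCurvature_eq_det {A : TangentSpace (𝓡 2) p →ₗ[ℝ] TangentSpace (𝓡 2) p}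
    (hA : ∀ v, diff f p (A v) = diff N p v) : gaussCurvature f N p = LinearMap.det A := by
  rw [gaussCurvature, shapeMatrix, secondFormMatrix_eq p hA, Matrix.det_mul, mul_comm,
    ← Matrix.det_mul, Matrix.mul_nonsing_inv_cancel_right _ _ (hf.isUnit_det_metricMatrix p),
    Matrix.det_transpose, LinearMap.det_toMatrix]

theorem cross_diff_normal_add (v w : TangentSpace (𝓡 2) p) :
    cross (diff N p v) (diff f p w) + cross (diff f p v) (diff N p w) =
      meanCurvature f N p • cross (diff f p v) (diff f p w) := by
  obtain ⟨A, hA⟩ := hf.exists_weingarten p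
  rw [hf.meanCurvature_eq_trace p hA, ← hA, ← hA]
  exact isAlt_apply_map_add_apply_map (tangentCross_isAlt f p) (tangentBasis p) A v w

theorem cross_diff_normal_diff_normal (v w : TangentSpace (𝓡 2) p) :
    cross (diff N p v) (diff N p w) =
      gaussCurvature f N p • cross (diff f p v) (diff f p w) := by
  obtain ⟨A, hA⟩ := hf.exists_weingarten p
  rw [hf.gaussCurvature_eq_det p hA, ← hA, ← hA]
  exact isAlt_apply_map_map (tangentCross_isAlt f p) (tangentBasis p) A v w

theorem metric_surfaceGradient_left (u : M → ℝ) (v : TangentSpace (𝓡 2) p) :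
    metric f p (surfaceGradient f u p) v = diffFun u p v := by
  let G : TangentSpace (𝓡 2) p →ₗ[ℝ] ℝ :=
    (innerSL ℝ (diff f p (surfaceGradient f u p))).toLinearMap ∘ₗ (diff f p).toLinearMap
  suffices h : G = (diffFun u p).toLinearMap from LinearMap.congr_fun h v
  refine Module.Basis.ext (tangentBasis p) fun j => ?_
  let a : Fin 2 → ℝ := fun j => diffFun u p (tangentBasis p j)
  have hcancel := Matrix.mul_nonsing_inv (metricMatrix f p) (hf.isUnit_det_metricMatrix p)
  calc G (tangentBasis p j)
      = ∑ i, (metricMatrix f p)⁻¹.mulVec a i * metricMatrix f p i j := by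
        change ⟪diff f p (surfaceGradient f u p), diff f p (tangentBasis p j)⟫ = _
        simp only [surfaceGradient, map_sum, map_smul, sum_inner, real_inner_smul_left]
        rfl
    _ = (metricMatrix f p).mulVec ((metricMatrix f p)⁻¹.mulVec a) j := by
        have hsymm (i : Fin 2) : metricMatrix f p i j = metricMatrix f p j i :=
          real_inner_comm (diff f p (tangentBasis p j)) (diff f p (tangentBasis p i))
        simp only [hsymm, mul_comm _ (metricMatrix f p j _)]
        rfl
    _ = a j := by rw [Matrix.mulVec_mulVec, hcancel, Matrix.one_mulVec]

theorem metric_surfaceGradient_right (u : M → ℝ) (v : TangentSpace (𝓡 2) p) :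
    metric f p v (surfaceGradient f u p) = diffFun u p v := by
  rw [metric, real_inner_comm]
  exact hf.metric_surfaceGradient_left p u v

/-- In other words, `du(w) v - du(v) w` is `∇u` rotated by `-π/2` and scaled by the area of the
parallelogram spanned by `v` and `w`. -/
theorem cross_normal_diff_eq (u : M → ℝ) (v w : TangentSpace (𝓡 2) p) :
    cross (N p) (diff f p (diffFun u p w • v - diffFun u p v • w)) =
      areaForm f N p v w • diff f p (surfaceGradient f u p) := by
  refine hf.eq_of_inner_diff_eq p (inner_cross_left_self _ _) ?_ fun z => ?_
  · rw [inner_smul_left, hf.inner_normal, mul_zero]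
  · have hcyclic := isAlt_smul_cyclic_sum (tangentCross_isAlt f p) (tangentBasis p)
      (diffFun u p).toLinearMap v w z
    have hcyclic' : diffFun u p v * areaForm f N p w z + diffFun u p w * areaForm f N p z v +
        diffFun u p z * areaForm f N p v w = 0 := by
      have := congrArg (fun X => ⟪X, N p⟫) hcyclic
      simp only [inner_add_left, real_inner_smul_left, inner_zero_left] at this
      exact this
    have hswap : areaForm f N p z v = -areaForm f N p v z := by
      rw [areaForm, ← neg_cross, inner_neg_left, areaForm]
    have hgrad := hf.metric_surfaceGradient_left p u z
    rw [metric] at hgrad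
    rw [inner_cross_rotate, real_inner_smul_left, hgrad, map_sub, map_smul, map_smul]
    simp only [map_sub, map_smul, sub_apply, smul_apply, inner_sub_left, real_inner_smul_left]
    change diffFun u p w * areaForm f N p v z - diffFun u p v * areaForm f N p w z = _
    rw [hswap] at hcyclic'
    linarith

end IsOrientedImmersion

end TangentPlane

section MovingFrame

variable {V : Type*} [NormedAddCommGroup V] [NormedSpace ℝ V] {F G : V → E3} {y : V}

theorem contDiffAt_fderiv_apply {E : Type*} [NormedAddCommGroup E] [NormedSpace ℝ E] {h : V → E}
    (hh : ContDiffAt ℝ ∞ h y) (a : V) : ContDiffAt ℝ ∞ (fun z => fderiv ℝ h z a) y :=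
  (hh.fderiv_right (m := ∞) (by simp)).clm_apply contDiffAt_const

theorem fderiv_fderiv_apply_comm {E : Type*} [NormedAddCommGroup E] [NormedSpace ℝ E] {h : V → E}
    (hh : ContDiffAt ℝ ∞ h y) (a b : V) :
    fderiv ℝ (fun z => fderiv ℝ h z a) y b = fderiv ℝ (fun z => fderiv ℝ h z b) y a := by
  have hd : DifferentiableAt ℝ (fderiv ℝ h) y :=
    (hh.fderiv_right (m := ∞) (by simp)).differentiableAt (by simp)
  have hsymm : IsSymmSndFDerivAt ℝ h y := hh.isSymmSndFDerivAt <| by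
    rw [minSmoothness_of_isRCLikeNormedField]
    exact WithTop.coe_le_coe.2 le_top
  rw [fderiv_clm_apply hd (differentiableAt_const a),
    fderiv_clm_apply hd (differentiableAt_const b)]
  simpa using hsymm b a

theorem contDiffAt_cross (hF : ContDiffAt ℝ ∞ F y) (hG : ContDiffAt ℝ ∞ G y) :
    ContDiffAt ℝ ∞ (fun z => cross (F z) (G z)) y :=
  (cross.contDiff.contDiffAt.comp y hF).clm_apply hG

theorem fderiv_cross (hF : DifferentiableAt ℝ F y) (hG : DifferentiableAt ℝ G y) (b : V) :
    fderiv ℝ (fun z => cross (F z) (G z)) y b =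
      cross (F y) (fderiv ℝ G y b) + cross (fderiv ℝ F y b) (G y) := by
  rw [(cross.hasFDerivAt_of_bilinear hF.hasFDerivAt hG.hasFDerivAt).fderiv]
  rfl

theorem fderiv_smul_cross_sub (hF : ContDiffAt ℝ ∞ F y) (hG : ContDiffAt ℝ ∞ G y)
    {h : V → ℝ} (hh : DifferentiableAt ℝ h y) (a b : V) :
    fderiv ℝ (fun z => h z • cross (G z) (fderiv ℝ F z a) - cross (G z) (fderiv ℝ G z a)) y b =
      fderiv ℝ h y b • cross (G y) (fderiv ℝ F y a) +
        h y • (cross (G y) (fderiv ℝ (fun z => fderiv ℝ F z a) y b) +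
          cross (fderiv ℝ G y b) (fderiv ℝ F y a)) -
        (cross (G y) (fderiv ℝ (fun z => fderiv ℝ G z a) y b) +
          cross (fderiv ℝ G y b) (fderiv ℝ G y a)) := by
  have hne : (∞ : WithTop ℕ∞) ≠ 0 := by simp
  have hG' := hG.differentiableAt hne
  have hFa := (contDiffAt_fderiv_apply hF a).differentiableAt hne
  have hGa := (contDiffAt_fderiv_apply hG a).differentiableAt hne
  have hGF := (contDiffAt_cross hG (contDiffAt_fderiv_apply hF a)).differentiableAt hne
  have hGG := (contDiffAt_cross hG (contDiffAt_fderiv_apply hG a)).differentiableAt hne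
  rw [fderiv_fun_sub (hh.fun_smul hGF) hGG, fderiv_fun_smul hh hGF, sub_apply,
    fderiv_cross hG' hGa]
  simp only [add_apply, smul_apply, ContinuousLinearMap.smulRight_apply]
  rw [fderiv_cross hG' hFa]
  module

/-- The exterior derivative of the one-form `h G × dF - G × dG` contains no second derivatives. -/
theorem fderiv_smul_cross_sub_antisymm (hF : ContDiffAt ℝ ∞ F y) (hG : ContDiffAt ℝ ∞ G y)
    {h : V → ℝ} (hh : DifferentiableAt ℝ h y) (a b : V) :
    fderiv ℝ (fun z => h z • cross (G z) (fderiv ℝ F z a) - cross (G z) (fderiv ℝ G z a)) y b -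
      fderiv ℝ (fun z => h z • cross (G z) (fderiv ℝ F z b) - cross (G z) (fderiv ℝ G z b)) y a =
    fderiv ℝ h y b • cross (G y) (fderiv ℝ F y a) - fderiv ℝ h y a • cross (G y) (fderiv ℝ F y b) -
      h y • (cross (fderiv ℝ G y a) (fderiv ℝ F y b) + cross (fderiv ℝ F y a) (fderiv ℝ G y b)) +
      (2 : ℝ) • cross (fderiv ℝ G y a) (fderiv ℝ G y b) := by
  rw [fderiv_smul_cross_sub hF hG hh, fderiv_smul_cross_sub hF hG hh,
    fderiv_fderiv_apply_comm hF a b, fderiv_fderiv_apply_comm hG a b,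
    ← neg_cross (fderiv ℝ G y b) (fderiv ℝ F y a), ← neg_cross (fderiv ℝ G y b) (fderiv ℝ G y a)]
  module

end MovingFrame

section Chart

variable {M : Type*} [TopologicalSpace M] [ChartedSpace E2 M]

/-- The coordinate vector field of the chart `e` with constant coordinates `a`, as a map
`a ↦ d(e⁻¹)_y a`. -/
def coordVec (e : OpenPartialHomeomorph M E2) (y : E2) : E2 →L[ℝ] TangentSpace (𝓡 2) (e.symm y) :=
  mfderiv (𝓡 2) (𝓡 2) e.symm y

variable [IsManifold (𝓡 2) ∞ M] {e : OpenPartialHomeomorph M E2} {y : E2}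
  {E : Type*} [NormedAddCommGroup E] [NormedSpace ℝ E]

theorem contDiffAt_comp_chart_symm (he : e ∈ atlas E2 M) {h : M → E}
    (hh : ContMDiff (𝓡 2) 𝓘(ℝ, E) ∞ h) (hy : y ∈ e.target) : ContDiffAt ℝ ∞ (h ∘ e.symm) y := by
  have hsymm : ContMDiffOn (𝓡 2) (𝓡 2) ∞ e.symm e.target :=
    contMDiffOn_symm_of_mem_maximalAtlas (IsManifold.subset_maximalAtlas he)
  exact ((hh.comp_contMDiffOn hsymm).contMDiffAt (e.open_target.mem_nhds hy)).contDiffAt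

theorem contMDiff_of_comp_chart_symm {n : ℕ∞} {h : M → E}
    (hh : ∀ e ∈ atlas E2 M, ∀ y ∈ e.target, ContDiffAt ℝ n (h ∘ e.symm) y) :
    ContMDiff (𝓡 2) 𝓘(ℝ, E) n h := by
  intro p
  have hsmooth : ContMDiffAt (𝓡 2) 𝓘(ℝ, E) n (h ∘ (chartAt E2 p).symm) (chartAt E2 p p) :=
    (hh _ (chart_mem_atlas E2 p) _ (mem_chart_target E2 p)).contMDiffAt
  have hchart : ContMDiffAt (𝓡 2) (𝓡 2) n (chartAt E2 p) p :=
    (contMDiffAt_of_mem_maximalAtlas (IsManifold.chart_mem_maximalAtlas p)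
      (mem_chart_source E2 p)).of_le (WithTop.coe_le_coe.2 le_top)
  refine (hsmooth.comp p hchart).congr_of_eventuallyEq ?_
  filter_upwards [(chartAt E2 p).open_source.mem_nhds (mem_chart_source E2 p)] with q hq
  simp only [Function.comp_apply, (chartAt E2 p).left_inv hq]

theorem mfderiv_coordVec (he : e ∈ atlas E2 M) {h : M → E}
    (hh : MDifferentiableAt (𝓡 2) 𝓘(ℝ, E) h (e.symm y)) (hy : y ∈ e.target) (a : E2) :
    mfderiv (𝓡 2) 𝓘(ℝ, E) h (e.symm y) (coordVec e y a) = fderiv ℝ (h ∘ e.symm) y a := by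
  have hchain := mfderiv_comp_apply y hh (mdifferentiableAt_atlas_symm he hy) a
  rw [mfderiv_eq_fderiv] at hchain
  exact hchain.symm

theorem coordVec_bijective (he : e ∈ atlas E2 M) (hy : y ∈ e.target) :
    Function.Bijective (coordVec e y) :=
  (mdifferentiable_of_mem_atlas (I := 𝓡 2) he).symm.mfderiv_bijective hy

end Chart

section Coordinates

variable {M : Type*} [TopologicalSpace M] [ChartedSpace E2 M] {f N : M → E3}

/-- The oriented area of the coordinate parallelogram of the chart `e`, that is, the area form in
coordinates. Its absolute value is `areaDensity f e`. -/
def coordArea (f N : M → E3) (e : OpenPartialHomeomorph M E2) (y : E2) : ℝ :=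
  areaForm f N (e.symm y) (coordVec e y (EuclideanSpace.single 0 1))
    (coordVec e y (EuclideanSpace.single 1 1))

/-- The coefficients `a ↦ w ω(d(e⁻¹) a)` in the chart `e` of the one-form `w ω`, where
`ω = dN ∘ J` is `rotatedDiffNormal`. -/
def coordForm (f N : M → E3) (w : M → ℝ) (e : OpenPartialHomeomorph M E2) (a y : E2) : E3 :=
  w (e.symm y) • rotatedDiffNormal f N (e.symm y) (coordVec e y a)

/-- The vector `dN(∇w) + w (df(∇H) - |𝒮|² N)`, which is `div(w ∇N)` because
`ΔN = df(∇H) - |𝒮|² N`. -/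
def divSmulGradNormal (f N : M → E3) (w : M → ℝ) (p : M) : E3 :=
  diff N p (surfaceGradient f w p) +
    w p • (diff f p (surfaceGradient f (meanCurvature f N) p) - normSqSecondForm f N p • N p)

variable [IsManifold (𝓡 2) ∞ M] {e : OpenPartialHomeomorph M E2} {y : E2}

omit [ChartedSpace E2 M] [IsManifold (𝓡 2) ∞ M] in
theorem areaDensity_eq_norm_cross (f : M → E3) (e : OpenPartialHomeomorph M E2) (y : E2) :
    areaDensity f e y = ‖cross (fderiv ℝ (f ∘ e.symm) y (EuclideanSpace.single 0 1))
      (fderiv ℝ (f ∘ e.symm) y (EuclideanSpace.single 1 1))‖ := by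
  rw [← Real.sqrt_sq (norm_nonneg _), norm_cross_sq, areaDensity]
  congr 2
  ext i j
  fin_cases i <;> fin_cases j <;> rfl

omit [IsManifold (𝓡 2) ∞ M] in
theorem exists_chart_symm_eq (p : M) : ∃ e ∈ atlas E2 M, ∃ y ∈ e.target, e.symm y = p :=
  ⟨chartAt E2 p, chart_mem_atlas E2 p, chartAt E2 p p, mem_chart_target E2 p,
    (chartAt E2 p).left_inv (mem_chart_source E2 p)⟩

theorem diff_coordVec (he : e ∈ atlas E2 M) (hy : y ∈ e.target) {h : M → E3}
    (hh : ContMDiff (𝓡 2) (𝓡 3) ∞ h) (a : E2) :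
    diff h (e.symm y) (coordVec e y a) = fderiv ℝ (h ∘ e.symm) y a :=
  mfderiv_coordVec he (hh.mdifferentiableAt (by simp)) hy a

theorem diffFun_coordVec (he : e ∈ atlas E2 M) (hy : y ∈ e.target) {u : M → ℝ}
    (hu : ContMDiff (𝓡 2) 𝓘(ℝ, ℝ) ∞ u) (a : E2) :
    diffFun u (e.symm y) (coordVec e y a) = fderiv ℝ (u ∘ e.symm) y a :=
  mfderiv_coordVec he (hu.mdifferentiableAt (by simp)) hy a

theorem contDiffAt_diff_coordVec (he : e ∈ atlas E2 M) (hy : y ∈ e.target) {h : M → E3}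
    (hh : ContMDiff (𝓡 2) (𝓡 3) ∞ h) (a : E2) :
    ContDiffAt ℝ ∞ (fun z => diff h (e.symm z) (coordVec e z a)) y := by
  refine (contDiffAt_fderiv_apply (contDiffAt_comp_chart_symm he hh hy) a).congr_of_eventuallyEq ?_
  filter_upwards [e.open_target.mem_nhds hy] with z hz
  exact diff_coordVec he hz hh a

namespace IsOrientedImmersion

variable (hf : IsOrientedImmersion f N)
include hf

theorem secondForm_symm (p : M) (v w : TangentSpace (𝓡 2) p) :
    secondForm f N p v w = secondForm f N p w v := by
  obtain ⟨e, he, y, hy, rfl⟩ := exists_chart_symm_eq p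
  obtain ⟨a, rfl⟩ := (coordVec_bijective he hy).2 v
  obtain ⟨b, rfl⟩ := (coordVec_bijective he hy).2 w
  have hF : ContDiffAt ℝ ∞ (f ∘ e.symm) y := contDiffAt_comp_chart_symm he hf.smooth hy
  have hN : ContDiffAt ℝ ∞ (N ∘ e.symm) y := contDiffAt_comp_chart_symm he hf.smooth_normal hy
  have hsecond (c d : E2) : ⟪fderiv ℝ (N ∘ e.symm) y d, fderiv ℝ (f ∘ e.symm) y c⟫ =
      -⟪(N ∘ e.symm) y, fderiv ℝ (fun z => fderiv ℝ (f ∘ e.symm) z c) y d⟫ := by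
    have horth : (fun z => ⟪(N ∘ e.symm) z, fderiv ℝ (f ∘ e.symm) z c⟫) =ᶠ[nhds y]
        fun _ => (0 : ℝ) := by
      filter_upwards [e.open_target.mem_nhds hy] with z hz
      rw [real_inner_comm, ← diff_coordVec he hz hf.smooth]
      exact hf.inner_normal _ _
    have hderiv := fderiv_inner_apply ℝ (hN.differentiableAt (by simp))
      ((contDiffAt_fderiv_apply hF c).differentiableAt (by simp)) d
    rw [horth.fderiv_eq, fderiv_fun_const] at hderiv
    exact eq_neg_of_add_eq_zero_right hderiv.symm
  have hsymm : ⟪fderiv ℝ (N ∘ e.symm) y a, fderiv ℝ (f ∘ e.symm) y b⟫ =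
      ⟪fderiv ℝ (N ∘ e.symm) y b, fderiv ℝ (f ∘ e.symm) y a⟫ := by
    rw [hsecond, hsecond, fderiv_fderiv_apply_comm hF]
  simp only [← diff_coordVec he hy hf.smooth, ← diff_coordVec he hy hf.smooth_normal] at hsymm
  exact hsymm

theorem diff_normal_eq_rotatedDiffNormal {p : M} {v w : TangentSpace (𝓡 2) p}
    (h : diff f p w = cross (N p) (diff f p v)) :
    diff N p w = rotatedDiffNormal f N p v := by
  refine hf.eq_of_inner_diff_eq p (hf.inner_diff_normal p w) ?_ fun z => ?_
  · rw [rotatedDiffNormal, inner_sub_left, real_inner_smul_left, inner_cross_left_self,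
      inner_cross_left_self, mul_zero, sub_zero]
  · have hadd := congrArg (fun X => ⟪X, N p⟫) (hf.cross_diff_normal_add p v z)
    simp only [inner_add_left, real_inner_smul_left] at hadd
    calc ⟪diff N p w, diff f p z⟫
        = ⟪diff N p z, cross (N p) (diff f p v)⟫ := h ▸ hf.secondForm_symm p w z
      _ = ⟪cross (diff f p v) (diff N p z), N p⟫ := by
        rw [real_inner_comm, inner_cross_rotate]
      _ = meanCurvature f N p * ⟪cross (diff f p v) (diff f p z), N p⟫ -
            ⟪cross (diff N p v) (diff f p z), N p⟫ := by linarith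
      _ = ⟪rotatedDiffNormal f N p v, diff f p z⟫ := by
        rw [rotatedDiffNormal, inner_sub_left, real_inner_smul_left,
          inner_cross_rotate (N p) (diff f p v), inner_cross_rotate (N p) (diff N p v)]

theorem rotatedDiffNormal_diffFun_eq (u : M → ℝ) (p : M) (v w : TangentSpace (𝓡 2) p) :
    diffFun u p w • rotatedDiffNormal f N p v - diffFun u p v • rotatedDiffNormal f N p w =
      areaForm f N p v w • diff N p (surfaceGradient f u p) := by
  have hrot := hf.diff_normal_eq_rotatedDiffNormal
    (((diff f p).map_smul _ _).trans (hf.cross_normal_diff_eq p u v w).symm)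
  rw [← map_smul, hrot]
  simp only [rotatedDiffNormal, map_sub, map_smul]
  module

theorem contDiffAt_coordArea (he : e ∈ atlas E2 M) (hy : y ∈ e.target) :
    ContDiffAt ℝ ∞ (coordArea f N e) y :=
  (contDiffAt_cross (contDiffAt_diff_coordVec he hy hf.smooth _)
    (contDiffAt_diff_coordVec he hy hf.smooth _)).inner ℝ
    (contDiffAt_comp_chart_symm he hf.smooth_normal hy)

theorem coordArea_ne_zero (he : e ∈ atlas E2 M) (hy : y ∈ e.target) : coordArea f N e y ≠ 0 := by
  apply hf.areaForm_ne_zero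
  have hbasis : LinearIndependent ℝ ![(EuclideanSpace.single 0 1 : E2),
      EuclideanSpace.single 1 1] := by
    have hvec : ⇑(EuclideanSpace.basisFun (Fin 2) ℝ) =
        ![EuclideanSpace.single 0 1, EuclideanSpace.single 1 1] := by
      ext i : 1
      fin_cases i <;> simp
    exact hvec ▸ (EuclideanSpace.basisFun (Fin 2) ℝ).orthonormal.linearIndependent
  have := hbasis.map' (coordVec e y).toLinearMap
    (LinearMap.ker_eq_bot.2 (coordVec_bijective he hy).1)
  rwa [← FinVec.map_eq] at this

theorem areaDensity_eq_abs_coordArea (he : e ∈ atlas E2 M) (hy : y ∈ e.target) :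
    areaDensity f e y = |coordArea f N e y| := by
  rw [areaDensity_eq_norm_cross, ← diff_coordVec he hy hf.smooth, ← diff_coordVec he hy hf.smooth]
  refine (congrArg norm (hf.cross_diff_eq (e.symm y) _ _)).trans ?_
  rw [norm_smul, hf.norm_normal, mul_one, Real.norm_eq_abs]
  rfl

theorem contMDiff_of_coordArea_smul {E : Type*} [NormedAddCommGroup E] [NormedSpace ℝ E] {n : ℕ∞}
    {h : M → E} (hh : ∀ e ∈ atlas E2 M, ∀ y ∈ e.target,
      ContDiffAt ℝ n (fun z => coordArea f N e z • h (e.symm z)) y) :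
    ContMDiff (𝓡 2) 𝓘(ℝ, E) n h := by
  refine contMDiff_of_comp_chart_symm fun e he y hy => ?_
  have hinv : ContDiffAt ℝ n (fun z => (coordArea f N e z)⁻¹) y :=
    ((hf.contDiffAt_coordArea he hy).of_le (WithTop.coe_le_coe.2 le_top)).inv
      (hf.coordArea_ne_zero he hy)
  refine (hinv.smul (hh e he y hy)).congr_of_eventuallyEq ?_
  filter_upwards [e.open_target.mem_nhds hy] with z hz
  exact (inv_smul_smul₀ (hf.coordArea_ne_zero he hz) _).symm

theorem contMDiff_meanCurvature : ContMDiff (𝓡 2) 𝓘(ℝ, ℝ) ∞ (meanCurvature f N) := by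
  refine hf.contMDiff_of_coordArea_smul fun e he y hy => ?_
  have hf' (i : Fin 2) := contDiffAt_diff_coordVec he hy hf.smooth (EuclideanSpace.single i 1)
  have hN' (i : Fin 2) :=
    contDiffAt_diff_coordVec he hy hf.smooth_normal (EuclideanSpace.single i 1)
  refine (((contDiffAt_cross (hN' 0) (hf' 1)).add (contDiffAt_cross (hf' 0) (hN' 1))).inner ℝ
    (contDiffAt_comp_chart_symm he hf.smooth_normal hy)).congr_of_eventuallyEq (.of_forall ?_)
  intro z
  have := congrArg (fun X => ⟪X, N (e.symm z)⟫) (hf.cross_diff_normal_add (e.symm z)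
    (coordVec e z (EuclideanSpace.single 0 1)) (coordVec e z (EuclideanSpace.single 1 1)))
  simp only [real_inner_smul_left] at this
  exact (mul_comm _ _).trans this.symm

theorem contMDiff_gaussCurvature : ContMDiff (𝓡 2) 𝓘(ℝ, ℝ) ∞ (gaussCurvature f N) := by
  refine hf.contMDiff_of_coordArea_smul fun e he y hy => ?_
  have hN' (i : Fin 2) :=
    contDiffAt_diff_coordVec he hy hf.smooth_normal (EuclideanSpace.single i 1)
  refine ((contDiffAt_cross (hN' 0) (hN' 1)).inner ℝ
    (contDiffAt_comp_chart_symm he hf.smooth_normal hy)).congr_of_eventuallyEq (.of_forall ?_)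
  intro z
  have := congrArg (fun X => ⟪X, N (e.symm z)⟫) (hf.cross_diff_normal_diff_normal (e.symm z)
    (coordVec e z (EuclideanSpace.single 0 1)) (coordVec e z (EuclideanSpace.single 1 1)))
  simp only [real_inner_smul_left] at this
  exact (mul_comm _ _).trans this.symm

theorem contMDiff_normSqSecondForm : ContMDiff (𝓡 2) 𝓘(ℝ, ℝ) ∞ (normSqSecondForm f N) :=
  (hf.contMDiff_meanCurvature.pow 2).sub (contMDiff_const.mul hf.contMDiff_gaussCurvature)

theorem contMDiff_diff_surfaceGradient {u : M → ℝ} (hu : ContMDiff (𝓡 2) 𝓘(ℝ, ℝ) ∞ u) :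
    ContMDiff (𝓡 2) (𝓡 3) ∞ fun p => diff f p (surfaceGradient f u p) := by
  refine hf.contMDiff_of_coordArea_smul fun e he y hy => ?_
  have hf' (i : Fin 2) := contDiffAt_diff_coordVec he hy hf.smooth (EuclideanSpace.single i 1)
  have hu' (i : Fin 2) := contDiffAt_fderiv_apply (contDiffAt_comp_chart_symm he hu hy)
    (EuclideanSpace.single i 1)
  refine (contDiffAt_cross (contDiffAt_comp_chart_symm he hf.smooth_normal hy)
    (((hu' 1).smul (hf' 0)).sub ((hu' 0).smul (hf' 1)))).congr_of_eventuallyEq ?_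
  filter_upwards [e.open_target.mem_nhds hy] with z hz
  refine (hf.cross_normal_diff_eq (e.symm z) u _ _).symm.trans ?_
  rw [diffFun_coordVec he hz hu, diffFun_coordVec he hz hu, map_sub, map_smul, map_smul]
  rfl

theorem continuous_metric_surfaceGradient {u v : M → ℝ} (hu : ContMDiff (𝓡 2) 𝓘(ℝ, ℝ) ∞ u)
    (hv : ContMDiff (𝓡 2) 𝓘(ℝ, ℝ) ∞ v) :
    Continuous fun p => metric f p (surfaceGradient f u p) (surfaceGradient f v p) :=
  (hf.contMDiff_diff_surfaceGradient hu).continuous.inner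
    (hf.contMDiff_diff_surfaceGradient hv).continuous

theorem rotatedDiffNormal_coordVec_eventuallyEq (he : e ∈ atlas E2 M) (hy : y ∈ e.target)
    (a : E2) : (fun z => rotatedDiffNormal f N (e.symm z) (coordVec e z a)) =ᶠ[nhds y] fun z =>
      (meanCurvature f N ∘ e.symm) z • cross ((N ∘ e.symm) z) (fderiv ℝ (f ∘ e.symm) z a) -
        cross ((N ∘ e.symm) z) (fderiv ℝ (N ∘ e.symm) z a) := by
  filter_upwards [e.open_target.mem_nhds hy] with z hz
  simp only [← diff_coordVec he hz hf.smooth, ← diff_coordVec he hz hf.smooth_normal]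
  rfl

theorem contDiffAt_rotatedDiffNormal_coordVec (he : e ∈ atlas E2 M) (hy : y ∈ e.target) (a : E2) :
    ContDiffAt ℝ ∞ (fun z => rotatedDiffNormal f N (e.symm z) (coordVec e z a)) y := by
  have hN : ContDiffAt ℝ ∞ (N ∘ e.symm) y := contDiffAt_comp_chart_symm he hf.smooth_normal hy
  have hF : ContDiffAt ℝ ∞ (f ∘ e.symm) y := contDiffAt_comp_chart_symm he hf.smooth hy
  exact (((contDiffAt_comp_chart_symm he hf.contMDiff_meanCurvature hy).smul
    (contDiffAt_cross hN (contDiffAt_fderiv_apply hF a))).sub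
    (contDiffAt_cross hN (contDiffAt_fderiv_apply hN a))).congr_of_eventuallyEq
    (hf.rotatedDiffNormal_coordVec_eventuallyEq he hy a)

theorem fderiv_rotatedDiffNormal_coordVec_sub (he : e ∈ atlas E2 M) (hy : y ∈ e.target)
    (a b : E2) :
    fderiv ℝ (fun z => rotatedDiffNormal f N (e.symm z) (coordVec e z a)) y b -
        fderiv ℝ (fun z => rotatedDiffNormal f N (e.symm z) (coordVec e z b)) y a =
      areaForm f N (e.symm y) (coordVec e y a) (coordVec e y b) •
        (diff f (e.symm y) (surfaceGradient f (meanCurvature f N) (e.symm y)) -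
          normSqSecondForm f N (e.symm y) • N (e.symm y)) := by
  have hH := hf.contMDiff_meanCurvature
  have hgrad := hf.cross_normal_diff_eq (e.symm y) (meanCurvature f N) (coordVec e y a)
    (coordVec e y b)
  have hadd := hf.cross_diff_normal_add (e.symm y) (coordVec e y a) (coordVec e y b)
  have hdet := hf.cross_diff_normal_diff_normal (e.symm y) (coordVec e y a) (coordVec e y b)
  rw [map_sub, map_smul, map_smul, map_sub, map_smul, map_smul, diffFun_coordVec he hy hH,
    diffFun_coordVec he hy hH] at hgrad
  rw [hf.cross_diff_eq] at hadd hdet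
  rw [diff_coordVec he hy hf.smooth, diff_coordVec he hy hf.smooth] at hgrad hadd
  rw [diff_coordVec he hy hf.smooth_normal, diff_coordVec he hy hf.smooth_normal] at hadd hdet
  rw [(hf.rotatedDiffNormal_coordVec_eventuallyEq he hy a).fderiv_eq,
    (hf.rotatedDiffNormal_coordVec_eventuallyEq he hy b).fderiv_eq,
    fderiv_smul_cross_sub_antisymm (contDiffAt_comp_chart_symm he hf.smooth hy)
      (contDiffAt_comp_chart_symm he hf.smooth_normal hy)
      ((contDiffAt_comp_chart_symm he hH hy).differentiableAt (by simp)), hadd, hdet]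
  refine (congrArg (· - _ + _) hgrad).trans ?_
  simp only [normSqSecondForm, Function.comp_apply]
  module

theorem contDiffAt_coordForm {w : M → ℝ} (hw : ContMDiff (𝓡 2) 𝓘(ℝ, ℝ) ∞ w)
    (he : e ∈ atlas E2 M) (hy : y ∈ e.target) (a : E2) :
    ContDiffAt ℝ ∞ (coordForm f N w e a) y :=
  (contDiffAt_comp_chart_symm he hw hy).smul (hf.contDiffAt_rotatedDiffNormal_coordVec he hy a)

theorem fderiv_coordForm {w : M → ℝ} (hw : ContMDiff (𝓡 2) 𝓘(ℝ, ℝ) ∞ w)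
    (he : e ∈ atlas E2 M) (hy : y ∈ e.target) (a b : E2) :
    fderiv ℝ (coordForm f N w e a) y b =
      w (e.symm y) • fderiv ℝ (fun z => rotatedDiffNormal f N (e.symm z) (coordVec e z a)) y b +
      diffFun w (e.symm y) (coordVec e y b) •
        rotatedDiffNormal f N (e.symm y) (coordVec e y a) := by
  have hω := (hf.contDiffAt_rotatedDiffNormal_coordVec he hy a).differentiableAt (by simp)
  have hw' := (contDiffAt_comp_chart_symm he hw hy).differentiableAt (by simp)
  rw [diffFun_coordVec he hy hw]
  exact DFunLike.congr_fun (fderiv_fun_smul hw' hω) b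

/-- In the chart `e`, the exterior derivative of `w ω` is `div(w ∇N)` times the area form. -/
theorem fderiv_coordForm_sub {w : M → ℝ} (hw : ContMDiff (𝓡 2) 𝓘(ℝ, ℝ) ∞ w)
    (he : e ∈ atlas E2 M) (hy : y ∈ e.target) :
    fderiv ℝ (coordForm f N w e (EuclideanSpace.single 0 1)) y (EuclideanSpace.single 1 1) -
        fderiv ℝ (coordForm f N w e (EuclideanSpace.single 1 1)) y (EuclideanSpace.single 0 1) =
      coordArea f N e y • divSmulGradNormal f N w (e.symm y) := by
  have hform := hf.fderiv_rotatedDiffNormal_coordVec_sub he hy (EuclideanSpace.single 0 1)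
    (EuclideanSpace.single 1 1)
  have hgrad := hf.rotatedDiffNormal_diffFun_eq w (e.symm y)
    (coordVec e y (EuclideanSpace.single 0 1)) (coordVec e y (EuclideanSpace.single 1 1))
  rw [hf.fderiv_coordForm hw he hy, hf.fderiv_coordForm hw he hy, divSmulGradNormal, smul_add,
    smul_comm, coordArea, ← hform, ← hgrad]
  module

theorem continuous_divSmulGradNormal {w : M → ℝ} (hw : ContMDiff (𝓡 2) 𝓘(ℝ, ℝ) ∞ w) :
    Continuous (divSmulGradNormal f N w) := by
  refine (hf.contMDiff_of_coordArea_smul (n := 0) fun e he y hy => ?_).continuous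
  have hderiv (a b : E2) := contDiffAt_fderiv_apply (hf.contDiffAt_coordForm hw he hy a) b
  refine (((hderiv (EuclideanSpace.single 0 1) (EuclideanSpace.single 1 1)).sub
    (hderiv (EuclideanSpace.single 1 1) (EuclideanSpace.single 0 1))).of_le
      (WithTop.coe_le_coe.2 bot_le)).congr_of_eventuallyEq ?_
  filter_upwards [e.open_target.mem_nhds hy] with z hz
  exact (hf.fderiv_coordForm_sub hw he hz).symm

end IsOrientedImmersion

end Coordinates

section AreaMeasure

open MeasureTheory

variable {M : Type*} [TopologicalSpace M] {f : M → E3} {e e' : OpenPartialHomeomorph M E2} {y : E2}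

theorem norm_cross_fderiv_comp {F : E2 → E3} {τ : E2 → E2} (hF : DifferentiableAt ℝ F (τ y))
    (hτ : DifferentiableAt ℝ τ y) :
    ‖cross (fderiv ℝ (F ∘ τ) y (EuclideanSpace.single 0 1))
        (fderiv ℝ (F ∘ τ) y (EuclideanSpace.single 1 1))‖ =
      |(fderiv ℝ τ y).det| * ‖cross (fderiv ℝ F (τ y) (EuclideanSpace.single 0 1))
        (fderiv ℝ F (τ y) (EuclideanSpace.single 1 1))‖ := by
  let B : E2 →ₗ[ℝ] E2 →ₗ[ℝ] E3 := cross.toLinearMap₁₂.compl₁₂ (fderiv ℝ F (τ y)).toLinearMap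
    (fderiv ℝ F (τ y)).toLinearMap
  have hB : B.IsAlt := fun v => cross_self (fderiv ℝ F (τ y) v)
  have hdet := isAlt_apply_map_map hB (EuclideanSpace.basisFun (Fin 2) ℝ).toBasis
    (fderiv ℝ τ y).toLinearMap (EuclideanSpace.single 0 1) (EuclideanSpace.single 1 1)
  rw [fderiv_comp y hF hτ]
  refine (congrArg norm hdet).trans ?_
  rw [norm_smul, Real.norm_eq_abs]
  rfl

section ChangeOfChart

variable [ChartedSpace E2 M] [IsManifold (𝓡 2) ∞ M]

theorem contDiffAt_transition (he : e ∈ atlas E2 M) (he' : e' ∈ atlas E2 M)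
    (hy : y ∈ e.target) (hy' : e.symm y ∈ e'.source) : ContDiffAt ℝ ∞ (e' ∘ e.symm) y := by
  have hsymm : ContMDiffAt (𝓡 2) (𝓡 2) ∞ e.symm y :=
    (contMDiffOn_symm_of_mem_maximalAtlas (IsManifold.subset_maximalAtlas he)).contMDiffAt
      (e.open_target.mem_nhds hy)
  have hchart : ContMDiffAt (𝓡 2) (𝓡 2) ∞ e' (e.symm y) :=
    contMDiffAt_of_mem_maximalAtlas (IsManifold.subset_maximalAtlas he') hy'
  exact (hchart.comp y hsymm).contDiffAt

theorem areaDensity_transition (hf : ContMDiff (𝓡 2) (𝓡 3) ∞ f) (he : e ∈ atlas E2 M)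
    (he' : e' ∈ atlas E2 M) (hy : y ∈ e.target) (hy' : e.symm y ∈ e'.source) :
    areaDensity f e y =
      |(fderiv ℝ (e' ∘ e.symm) y).det| * areaDensity f e' ((e' ∘ e.symm) y) := by
  have heq : f ∘ e.symm =ᶠ[nhds y] (f ∘ e'.symm) ∘ (e' ∘ e.symm) := by
    filter_upwards [(e.continuousAt_symm hy).eventually (e'.open_source.mem_nhds hy')] with z hz
    simp only [Function.comp_apply, e'.left_inv hz]
  rw [areaDensity_eq_norm_cross, areaDensity_eq_norm_cross, heq.fderiv_eq]
  exact norm_cross_fderiv_comp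
    ((contDiffAt_comp_chart_symm he' hf (e'.map_source hy')).differentiableAt (by simp))
    ((contDiffAt_transition he he' hy hy').differentiableAt (by simp))

theorem continuousOn_areaDensity (hf : ContMDiff (𝓡 2) (𝓡 3) ∞ f) (he : e ∈ atlas E2 M) :
    ContinuousOn (areaDensity f e) e.target := by
  intro y hy
  have hfderiv := contDiffAt_fderiv_apply (contDiffAt_comp_chart_symm he hf hy)
  refine ContinuousAt.continuousWithinAt ?_
  rw [funext (areaDensity_eq_norm_cross f e)]
  exact (contDiffAt_cross (hfderiv _) (hfderiv _)).continuousAt.norm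

end ChangeOfChart

variable [MeasurableSpace M] [BorelSpace M]

theorem measurableSet_target_inter_preimage_symm (e : OpenPartialHomeomorph M E2) {s : Set M}
    (hs : MeasurableSet s) : MeasurableSet (e.target ∩ e.symm ⁻¹' s) := by
  have himage := e.open_target.measurableSet.subtype_image
    (e.continuousOn_symm.domRestrict.measurable hs)
  rwa [Set.domRestrict_eq, Set.preimage_comp, Subtype.image_preimage_coe] at himage

theorem aemeasurable_symm (f : M → E3) (e : OpenPartialHomeomorph M E2) :
    AEMeasurable e.symm ((volume.restrict e.target).withDensity
      fun y => ENNReal.ofReal (areaDensity f e y)) :=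
  (e.continuousOn_symm.aemeasurable e.open_target.measurableSet).mono_ac
    (withDensity_absolutelyContinuous _ _)

theorem chartArea_apply (f : M → E3) (e : OpenPartialHomeomorph M E2) {s : Set M}
    (hs : MeasurableSet s) : chartArea f e s =
      ∫⁻ y in e.target ∩ e.symm ⁻¹' s, ENNReal.ofReal (areaDensity f e y) := by
  rw [chartArea, Measure.map_apply_of_aemeasurable (aemeasurable_symm f e) hs, withDensity_apply',
    Measure.restrict_restrict' e.open_target.measurableSet, Set.inter_comm]

theorem chartArea_compl_source (f : M → E3) (e : OpenPartialHomeomorph M E2) :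
    chartArea f e e.sourceᶜ = 0 := by
  have hempty : e.target ∩ e.symm ⁻¹' e.sourceᶜ = ∅ :=
    Set.eq_empty_of_forall_notMem fun y hy => hy.2 (e.map_target hy.1)
  rw [chartArea_apply f e e.open_source.measurableSet.compl, hempty, Measure.restrict_empty,
    lintegral_zero_measure]

variable [ChartedSpace E2 M] [IsManifold (𝓡 2) ∞ M]

theorem chartArea_eq_of_subset (hf : ContMDiff (𝓡 2) (𝓡 3) ∞ f) (he : e ∈ atlas E2 M)
    (he' : e' ∈ atlas E2 M) {s : Set M} (hs : MeasurableSet s) (hse : s ⊆ e.source)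
    (hse' : s ⊆ e'.source) : chartArea f e s = chartArea f e' s := by
  rw [chartArea_apply f e hs, chartArea_apply f e' hs]
  have hmeas := measurableSet_target_inter_preimage_symm e hs
  have himage : e'.target ∩ e'.symm ⁻¹' s = (e' ∘ e.symm) '' (e.target ∩ e.symm ⁻¹' s) := by
    rw [← e'.image_eq_target_inter_inv_preimage hse', ← e.image_eq_target_inter_inv_preimage hse,
      Set.image_comp, Set.LeftInvOn.image_image (e.leftInvOn.mono hse)]
  have hinj : Set.InjOn (e' ∘ e.symm) (e.target ∩ e.symm ⁻¹' s) := fun y hy z hz h =>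
    e.symm.injOn hy.1 hz.1 (e'.injOn (hse' hy.2) (hse' hz.2) h)
  have hderiv : ∀ y ∈ e.target ∩ e.symm ⁻¹' s, HasFDerivWithinAt (e' ∘ e.symm)
      (fderiv ℝ (e' ∘ e.symm) y) (e.target ∩ e.symm ⁻¹' s) y := fun y hy =>
    ((contDiffAt_transition he he' hy.1 (hse' hy.2)).differentiableAt
      (by simp)).hasFDerivAt.hasFDerivWithinAt
  rw [himage, lintegral_image_eq_lintegral_abs_det_fderiv_mul _ hmeas hderiv hinj]
  refine setLIntegral_congr_fun hmeas fun y hy => ?_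
  rw [areaDensity_transition hf he he' hy.1 (hse' hy.2), ENNReal.ofReal_mul (abs_nonneg _)]

theorem chartArea_inter_source_le (hf : ContMDiff (𝓡 2) (𝓡 3) ∞ f) (he : e ∈ atlas E2 M)
    (he' : e' ∈ atlas E2 M) {s : Set M} (hs : MeasurableSet s) :
    chartArea f e' (s ∩ e.source) ≤ chartArea f e s := by
  have hms := e.open_source.measurableSet
  have hms' := e'.open_source.measurableSet
  calc chartArea f e' (s ∩ e.source)
      = chartArea f e' (s ∩ e.source ∩ e'.source) := by
        rw [← measure_inter_add_sdiff (s ∩ e.source) hms',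
          measure_mono_null (s := (s ∩ e.source) \ e'.source) (fun x hx => hx.2)
            (chartArea_compl_source f e'), add_zero]
    _ = chartArea f e (s ∩ e.source ∩ e'.source) :=
        chartArea_eq_of_subset hf he' he ((hs.inter hms).inter hms') (fun x hx => hx.2)
          fun x hx => hx.1.2
    _ ≤ chartArea f e s := measure_mono fun x hx => hx.1.1

theorem area_restrict_source (hf : ContMDiff (𝓡 2) (𝓡 3) ∞ f) (he : e ∈ atlas E2 M) :
    (area f).restrict e.source = chartArea f e := by
  have hms := e.open_source.measurableSet
  have hself : (chartArea f e).restrict e.source = chartArea f e :=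
    Measure.restrict_eq_self_of_ae_mem (chartArea_compl_source f e)
  have hle (e' : OpenPartialHomeomorph M E2) (he' : e' ∈ atlas E2 M) : chartArea f e' ≤ area f :=
    le_iSup₂_of_le e' he' le_rfl
  apply le_antisymm
  · have hdom : area f ≤ chartArea f e + (area f).restrict e.sourceᶜ := by
      refine iSup₂_le fun e' he' => Measure.le_iff.2 fun s hs => ?_
      rw [← measure_inter_add_sdiff s hms, Measure.add_apply, Measure.restrict_apply hs]
      exact add_le_add (chartArea_inter_source_le hf he he' hs) (hle e' he' _)
    refine (Measure.restrict_mono_measure hdom e.source).trans ?_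
    rw [Measure.restrict_add, hself, Measure.restrict_restrict hms, Set.inter_compl_self,
      Measure.restrict_empty, add_zero]
  · rw [← hself]
    exact Measure.restrict_mono_measure (hle e he) _

theorem isLocallyFiniteMeasure_area (hf : ContMDiff (𝓡 2) (𝓡 3) ∞ f) :
    IsLocallyFiniteMeasure (area f) := by
  refine ⟨fun p => ?_⟩
  obtain ⟨e, he, hp⟩ : ∃ e ∈ atlas E2 M, p ∈ e.source :=
    ⟨chartAt E2 p, chart_mem_atlas E2 p, mem_chart_source E2 p⟩
  obtain ⟨K, hKcompact, hpK, hKtarget⟩ := exists_compact_subset e.open_target (e.map_source hp)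
  have hopen : IsOpen (e.source ∩ e ⁻¹' interior K) := e.isOpen_inter_preimage isOpen_interior
  refine ⟨e.source ∩ e ⁻¹' interior K, hopen.mem_nhds ⟨hp, hpK⟩, ?_⟩
  have hint : IntegrableOn (areaDensity f e) K :=
    ((continuousOn_areaDensity hf he).mono hKtarget).integrableOn_compact hKcompact
  rw [← Set.inter_eq_left.2 (Set.inter_subset_left (s := e.source) (t := e ⁻¹' interior K)),
    ← Measure.restrict_apply hopen.measurableSet, area_restrict_source hf he,
    chartArea_apply f e hopen.measurableSet]
  refine (lintegral_mono_set ?_).trans_lt hint.lintegral_lt_top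
  rintro y ⟨hy, -, hyK⟩
  rw [Set.mem_preimage, e.right_inv hy] at hyK
  exact interior_subset hyK

theorem integral_area_eq {E : Type*} [NormedAddCommGroup E] [NormedSpace ℝ E]
    (hf : ContMDiff (𝓡 2) (𝓡 3) ∞ f) (he : e ∈ atlas E2 M) {h : M → E}
    (hh : AEStronglyMeasurable h (area f)) (hsupp : ∀ p ∉ e.source, h p = 0) :
    ∫ p, h p ∂area f = ∫ y in e.target, areaDensity f e y • h (e.symm y) := by
  have hh' : AEStronglyMeasurable h (chartArea f e) := by
    rw [← area_restrict_source hf he]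
    exact hh.restrict
  have hdensity : AEMeasurable (fun y => ENNReal.ofReal (areaDensity f e y))
      (volume.restrict e.target) :=
    ((continuousOn_areaDensity hf he).aemeasurable e.open_target.measurableSet).ennreal_ofReal
  rw [← setIntegral_eq_integral_of_forall_compl_eq_zero hsupp, area_restrict_source hf he,
    chartArea, integral_map (aemeasurable_symm f e) hh',
    integral_withDensity_eq_integral_toReal_smul₀ hdensity (by simp)]
  simp only [ENNReal.toReal_ofReal, areaDensity, Real.sqrt_nonneg]

end AreaMeasure

section Divergence

open MeasureTheory

section NormedSpace

variable {V E : Type*} [NormedAddCommGroup V] [NormedSpace ℝ V] [NormedAddCommGroup E]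
  [NormedSpace ℝ E] {X : V → E} {K U : Set V}

theorem contDiff_indicator {n : WithTop ℕ∞} (hX : ContDiffOn ℝ n X U) (hU : IsOpen U)
    (hK : IsClosed K) (hKU : K ⊆ U) (hzero : ∀ y ∈ U \ K, X y = 0) :
    ContDiff ℝ n (K.indicator X) := by
  refine contDiff_iff_contDiffAt.2 fun y => ?_
  by_cases hy : y ∈ K
  · refine (hX.contDiffAt (hU.mem_nhds (hKU hy))).congr_of_eventuallyEq ?_
    filter_upwards [hU.mem_nhds (hKU hy)] with z hz
    exact Set.indicator_apply_eq_self.2 fun hzK => hzero z ⟨hz, hzK⟩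
  · refine (contDiffAt_const (c := (0 : E))).congr_of_eventuallyEq ?_
    filter_upwards [hK.isOpen_compl.mem_nhds hy] with z hz
    exact Set.indicator_of_notMem hz X

variable [MeasurableSpace V] [BorelSpace V] {μ : Measure V}

theorem integrable_fderiv_apply [IsFiniteMeasureOnCompacts μ] (hX : ContDiff ℝ 1 X)
    (hc : HasCompactSupport X)
    (v : V) : Integrable (fun y => fderiv ℝ X y v) μ :=
  Continuous.integrable_of_hasCompactSupport
    ((hX.continuous_fderiv one_ne_zero).clm_apply continuous_const)
    ((hc.fderiv (𝕜 := ℝ)).comp_left (g := fun L : V →L[ℝ] E => L v) rfl)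

variable [FiniteDimensional ℝ V] [μ.IsAddHaarMeasure]

theorem integral_fderiv_apply_eq_zero (hX : ContDiff ℝ 1 X) (hc : HasCompactSupport X) (v : V) :
    ∫ y, fderiv ℝ X y v ∂μ = 0 := by
  have hparts := integral_smul_fderiv_eq_neg_fderiv_smul_of_integrable (μ := μ)
    (f := fun _ => (1 : ℝ)) (g := X) (v := v) (by simp)
    (by simpa using integrable_fderiv_apply hX hc v)
    (by simpa using hX.continuous.integrable_of_hasCompactSupport hc)
    (fun _ _ => differentiableAt_const _) (fun _ _ => hX.differentiable one_ne_zero _)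
  simpa using hparts

theorem setIntegral_fderiv_apply_sub_eq_zero {Y : V → E} (hX : ContDiffOn ℝ 1 X U)
    (hY : ContDiffOn ℝ 1 Y U) (hU : IsOpen U) (hK : IsCompact K) (hKU : K ⊆ U)
    (hX0 : ∀ y ∈ U \ K, X y = 0) (hY0 : ∀ y ∈ U \ K, Y y = 0) (v w : V) :
    ∫ y in U, (fderiv ℝ X y v - fderiv ℝ Y y w) ∂μ = 0 := by
  have hextend {Z : V → E} (hZ0 : ∀ y ∈ U \ K, Z y = 0) {y : V} (hy : y ∈ U) :
      fderiv ℝ Z y = fderiv ℝ (K.indicator Z) y := by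
    refine Filter.EventuallyEq.fderiv_eq ?_
    filter_upwards [hU.mem_nhds hy] with z hz
    exact (Set.indicator_apply_eq_self.2 fun hzK => hZ0 z ⟨hz, hzK⟩).symm
  have houtside {Z : V → E} {y : V} (hy : y ∉ U) : fderiv ℝ (K.indicator Z) y = 0 :=
    fderiv_of_notMem_tsupport (𝕜 := ℝ) fun hmem => hy (hKU (closure_minimal
      Set.support_indicator_subset hK.isClosed hmem))
  have hcompact (Z : V → E) : HasCompactSupport (K.indicator Z) :=
    HasCompactSupport.intro hK fun y hy => Set.indicator_of_notMem hy Z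
  have hX' := contDiff_indicator hX hU hK.isClosed hKU hX0
  have hY' := contDiff_indicator hY hU hK.isClosed hKU hY0
  calc ∫ y in U, (fderiv ℝ X y v - fderiv ℝ Y y w) ∂μ
      = ∫ y in U, (fderiv ℝ (K.indicator X) y v - fderiv ℝ (K.indicator Y) y w) ∂μ :=
        setIntegral_congr_fun hU.measurableSet fun y hy => by
          simp only [hextend hX0 hy, hextend hY0 hy]
    _ = ∫ y, (fderiv ℝ (K.indicator X) y v - fderiv ℝ (K.indicator Y) y w) ∂μ :=
        setIntegral_eq_integral_of_forall_compl_eq_zero fun y hy => by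
          simp only [houtside hy, zero_apply, sub_self]
    _ = 0 := by
        rw [integral_sub (integrable_fderiv_apply hX' (hcompact X) v)
          (integrable_fderiv_apply hY' (hcompact Y) w), integral_fderiv_apply_eq_zero hX'
          (hcompact X), integral_fderiv_apply_eq_zero hY' (hcompact Y), sub_self]

end NormedSpace

theorem sign_eventuallyEq {T : Type*} [TopologicalSpace T] {c : T → ℝ} {y : T}
    (hc : ContinuousAt c y) (hne : c y ≠ 0) :
    (fun z => SignType.sign (c z)) =ᶠ[nhds y] fun _ => SignType.sign (c y) :=
  ((continuousAt_sign_of_ne_zero hne).comp hc).eventually_mem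
    (IsOpen.mem_nhds (isOpen_discrete {SignType.sign (c y)}) rfl)

variable {M : Type*} [TopologicalSpace M] [ChartedSpace E2 M] {f N : M → E3} {w : M → ℝ}

theorem surfaceGradient_eq_zero_of_notMem_tsupport {p : M} (hp : p ∉ tsupport w) :
    surfaceGradient f w p = 0 := by
  have hw : w =ᶠ[nhds p] fun _ => (0 : ℝ) := notMem_tsupport_iff_eventuallyEq.1 hp
  exact surfaceGradient_eq_zero (hw.mfderiv_eq.trans mfderiv_const)

theorem support_divSmulGradNormal_subset :
    Function.support (divSmulGradNormal f N w) ⊆ tsupport w := by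
  refine Function.support_subset_iff'.2 fun p hp => ?_
  rw [divSmulGradNormal, surfaceGradient_eq_zero_of_notMem_tsupport hp,
    image_eq_zero_of_notMem_tsupport hp, map_zero, zero_smul, add_zero]

theorem hasCompactSupport_divSmulGradNormal [T2Space M] (hc : HasCompactSupport w) :
    HasCompactSupport (divSmulGradNormal f N w) :=
  hc.mono' support_divSmulGradNormal_subset

theorem divSmulGradNormal_add {u : M → ℝ} (hu : ContMDiff (𝓡 2) 𝓘(ℝ, ℝ) ∞ u)
    (hw : ContMDiff (𝓡 2) 𝓘(ℝ, ℝ) ∞ w) :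
    divSmulGradNormal f N (u + w) = divSmulGradNormal f N u + divSmulGradNormal f N w := by
  funext p
  simp only [divSmulGradNormal, Pi.add_apply, surfaceGradient_add f (hu.mdifferentiableAt (by simp))
    (hw.mdifferentiableAt (by simp)), map_add]
  module

theorem exists_finset_eq_sum_partition_mul {ι : Type*} (ρ : SmoothPartitionOfUnity ι (𝓡 2) M)
    (hc : HasCompactSupport w) : ∃ t : Finset ι, w = ∑ i ∈ t, ⇑(ρ i) * w := by
  have hfinite : {i | (Function.support (ρ i) ∩ tsupport w).Nonempty}.Finite :=
    ρ.locallyFinite.finite_nonempty_inter_compact hc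
  refine ⟨hfinite.toFinset, funext fun p => ?_⟩
  rw [← Finset.sum_mul, Pi.mul_apply, Finset.sum_apply]
  by_cases hp : w p = 0
  · rw [hp, mul_zero]
  · have hsupport : Function.support (fun i => ρ i p) ⊆ hfinite.toFinset := fun i hi =>
      hfinite.mem_toFinset.2 ⟨p, hi, subset_tsupport _ hp⟩
    rw [← finsum_eq_sum_of_support_subset _ hsupport, ρ.sum_eq_one (Set.mem_univ p), one_mul]

variable [IsManifold (𝓡 2) ∞ M]

theorem contMDiff_compactSupport_induction [T2Space M] [SecondCountableTopology M]
    {P : (M → ℝ) → Prop} (zero : P 0)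
    (sum : ∀ u w, ContMDiff (𝓡 2) 𝓘(ℝ, ℝ) ∞ u → HasCompactSupport u →
      ContMDiff (𝓡 2) 𝓘(ℝ, ℝ) ∞ w → HasCompactSupport w → P u → P w → P (u + w))
    (chart : ∀ e ∈ atlas E2 M, ∀ u, ContMDiff (𝓡 2) 𝓘(ℝ, ℝ) ∞ u → HasCompactSupport u →
      tsupport u ⊆ e.source → P u)
    (hw : ContMDiff (𝓡 2) 𝓘(ℝ, ℝ) ∞ w) (hc : HasCompactSupport w) : P w := by
  classical
  have : LocallyCompactSpace M := ChartedSpace.locallyCompactSpace E2 M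
  obtain ⟨ρ, hρ⟩ := SmoothPartitionOfUnity.exists_isSubordinate_chartAt_source (𝓡 2) M
  have hpartial (t : Finset M) : ContMDiff (𝓡 2) 𝓘(ℝ, ℝ) ∞ (∑ i ∈ t, ⇑(ρ i) * w) ∧
      HasCompactSupport (∑ i ∈ t, ⇑(ρ i) * w) ∧ P (∑ i ∈ t, ⇑(ρ i) * w) := by
    induction t using Finset.induction_on with
    | empty =>
      rw [Finset.sum_empty]
      exact ⟨contMDiff_const, HasCompactSupport.zero, zero⟩
    | insert i t hi ih =>
      obtain ⟨hsmooth, hcompact, hP⟩ := ih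
      have hsmooth_i : ContMDiff (𝓡 2) 𝓘(ℝ, ℝ) ∞ (⇑(ρ i) * w) := (ρ i).contMDiff.mul hw
      have hcompact_i : HasCompactSupport (⇑(ρ i) * w) := hc.mul_left
      have hP_i : P (⇑(ρ i) * w) := chart _ (chart_mem_atlas E2 i) _ hsmooth_i hcompact_i
        (tsupport_mul_subset_left.trans (hρ i))
      rw [Finset.sum_insert hi]
      exact ⟨hsmooth_i.add hsmooth, hcompact_i.add hcompact,
        sum _ _ hsmooth_i hcompact_i hsmooth hcompact hP_i hP⟩
  obtain ⟨t, hsum⟩ := exists_finset_eq_sum_partition_mul ρ hc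
  rw [hsum]
  exact (hpartial _).2.2

variable [MeasurableSpace M] [BorelSpace M]

namespace IsOrientedImmersion

variable (hf : IsOrientedImmersion f N)
include hf

theorem integrable_divSmulGradNormal [T2Space M] (hw : ContMDiff (𝓡 2) 𝓘(ℝ, ℝ) ∞ w)
    (hc : HasCompactSupport w) : Integrable (divSmulGradNormal f N w) (area f) :=
  have := isLocallyFiniteMeasure_area hf.smooth
  (hf.continuous_divSmulGradNormal hw).integrable_of_hasCompactSupport
    (hasCompactSupport_divSmulGradNormal hc)

theorem integral_divSmulGradNormal_of_tsupport_subset (hw : ContMDiff (𝓡 2) 𝓘(ℝ, ℝ) ∞ w)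
    (hc : HasCompactSupport w) {e : OpenPartialHomeomorph M E2} (he : e ∈ atlas E2 M)
    (hsub : tsupport w ⊆ e.source) : ∫ p, divSmulGradNormal f N w p ∂area f = 0 := by
  -- The charts need not be compatible with the orientation `N`; the sign turns the oriented area
  -- `coordArea` into the positive density `areaDensity`.
  let X (a y : E2) : E3 := (SignType.sign (coordArea f N e y) : ℝ) • coordForm f N w e a y
  have hX {y : E2} (hy : y ∈ e.target) (a : E2) : X a =ᶠ[nhds y]
      fun z => (SignType.sign (coordArea f N e y) : ℝ) • coordForm f N w e a z := by
    filter_upwards [sign_eventuallyEq (hf.contDiffAt_coordArea he hy).continuousAt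
      (hf.coordArea_ne_zero he hy)] with z hz
    simp only [X, hz]
  have hsmooth (a : E2) : ContDiffOn ℝ 1 (X a) e.target := fun y hy =>
    ((((hf.contDiffAt_coordForm hw he hy a).const_smul _).of_le
      (by simp)).congr_of_eventuallyEq (hX hy a)).contDiffWithinAt
  have hzero (a : E2) : ∀ y ∈ e.target \ e '' tsupport w, X a y = 0 := fun y hy => by
    have hwy : w (e.symm y) = 0 := image_eq_zero_of_notMem_tsupport fun hmem =>
      hy.2 ⟨_, hmem, e.right_inv hy.1⟩
    simp only [X, coordForm, hwy, zero_smul, smul_zero]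
  have hderiv {y : E2} (hy : y ∈ e.target) (a b : E2) : fderiv ℝ (X a) y b =
      (SignType.sign (coordArea f N e y) : ℝ) • fderiv ℝ (coordForm f N w e a) y b := by
    rw [(hX hy a).fderiv_eq, fderiv_fun_const_smul
      ((hf.contDiffAt_coordForm hw he hy a).differentiableAt (by simp)), smul_apply]
  rw [integral_area_eq hf.smooth he (hf.continuous_divSmulGradNormal hw).aestronglyMeasurable
    fun p hp => Function.notMem_support.1 fun h => hp (hsub (support_divSmulGradNormal_subset h))]
  refine (setIntegral_congr_fun e.open_target.measurableSet fun y hy => ?_).trans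
    (setIntegral_fderiv_apply_sub_eq_zero (hsmooth (EuclideanSpace.single 0 1))
      (hsmooth (EuclideanSpace.single 1 1)) e.open_target
      (hc.isCompact.image_of_continuousOn (e.continuousOn.mono hsub))
      (Set.image_subset_iff.2 fun p hp => e.map_source (hsub hp)) (hzero _) (hzero _)
      (EuclideanSpace.single 1 1) (EuclideanSpace.single 0 1))
  simp only [hderiv hy, ← smul_sub]
  rw [hf.fderiv_coordForm_sub hw he hy, smul_smul, sign_mul_self,
    hf.areaDensity_eq_abs_coordArea he hy]

theorem integral_divSmulGradNormal [T2Space M] [SecondCountableTopology M]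
    (hw : ContMDiff (𝓡 2) 𝓘(ℝ, ℝ) ∞ w) (hc : HasCompactSupport w) :
    ∫ p, divSmulGradNormal f N w p ∂area f = 0 := by
  refine contMDiff_compactSupport_induction (P := fun w =>
    ∫ p, divSmulGradNormal f N w p ∂area f = 0) ?_ (fun u w hu huc hw hwc hu0 hw0 => ?_)
    (fun e he u hu huc => hf.integral_divSmulGradNormal_of_tsupport_subset hu huc he) hw hc
  · have hzero : divSmulGradNormal f N (0 : M → ℝ) = 0 :=
      Function.support_eq_empty_iff.1 (Set.subset_empty_iff.1
        (support_divSmulGradNormal_subset.trans_eq (tsupport_eq_empty_iff.2 rfl)))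
    rw [hzero, Pi.zero_def, integral_zero]
  · rw [divSmulGradNormal_add hu hw, integral_add' (hf.integrable_divSmulGradNormal hu huc)
      (hf.integrable_divSmulGradNormal hw hwc), hu0, hw0, add_zero]

end IsOrientedImmersion

end Divergence

section Stability

open MeasureTheory

theorem isOpen_coe_gt (α : WithBot ℝ) : IsOpen {z : ℝ | α < (z : WithBot ℝ)} := by
  induction α using WithBot.recBotCoe with
  | bot => simp only [WithBot.bot_lt_coe, Set.ofPred_true, isOpen_univ]
  | coe a =>
    simp only [WithBot.coe_lt_coe]
    exact isOpen_Ioi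

theorem contDiffAt_deriv {χ : ℝ → ℝ} {t : ℝ} (hχ : ContDiffAt ℝ ∞ χ t) :
    ContDiffAt ℝ ∞ (deriv χ) t := by
  simpa only [fderiv_apply_one_eq_deriv] using contDiffAt_fderiv_apply hχ 1

theorem tendsto_integral_mul_div_add {X : Type*} [MeasurableSpace X] {μ : Measure X} {g η : X → ℝ}
    (hg : Integrable g μ) (hη : AEMeasurable η μ) (hη0 : ∀ x, 0 ≤ η x)
    (hzero : ∀ x, η x = 0 → g x = 0) :
    Filter.Tendsto (fun ε => ∫ x, g x * (ε / (η x + ε)) ∂μ) (nhdsWithin 0 (Set.Ioi 0))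
      (nhds 0) := by
  suffices h : Filter.Tendsto (fun ε => ∫ x, g x * (ε / (η x + ε)) ∂μ)
      (nhdsWithin 0 (Set.Ioi 0)) (nhds (∫ _, (0 : ℝ) ∂μ)) by rwa [integral_zero] at h
  refine tendsto_integral_filter_of_dominated_convergence (fun x => ‖g x‖)
    (Filter.Eventually.of_forall fun ε => ?_) ?_ hg.norm (Filter.Eventually.of_forall fun x => ?_)
  · exact hg.aestronglyMeasurable.mul
      (aemeasurable_const.div (hη.add_const ε)).aestronglyMeasurable
  · filter_upwards [self_mem_nhdsWithin] with ε hε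
    refine Filter.Eventually.of_forall fun x => ?_
    have hpos : 0 < η x + ε := add_pos_of_nonneg_of_pos (hη0 x) hε
    rw [norm_mul, Real.norm_of_nonneg (div_nonneg (le_of_lt hε) hpos.le)]
    refine mul_le_of_le_one_right (norm_nonneg _) ((div_le_one hpos).2 ?_)
    exact le_add_of_nonneg_left (hη0 x)
  · rcases (hη0 x).eq_or_lt with h0 | hpos
    · simp only [hzero x h0.symm, zero_mul]
      exact tendsto_const_nhds
    · have hquot : ContinuousAt (fun ε : ℝ => g x * (ε / (η x + ε))) 0 :=
        continuousAt_const.mul (continuousAt_id.div (continuousAt_const.add continuousAt_id)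
          (by simpa using hpos.ne'))
      simpa using hquot.tendsto.mono_left nhdsWithin_le_nhds

variable {M : Type*} [TopologicalSpace M] [ChartedSpace E2 M] {φ : ℝ → ℝ} {f N : M → E3} {p : M}

theorem IsPhiMinimal.meanCurvature_eq_neg (hmin : IsPhiMinimal φ f N)
    (hφ : DifferentiableAt ℝ φ (height f p)) :
    meanCurvature f N p = -(deriv φ (height f p) * angle N p) := by
  have hlinear : (fun x : E3 => ⟪x, e3⟫) = innerSL ℝ e3 := funext fun x => real_inner_comm e3 x
  have hderiv : HasFDerivAt (fun x : E3 => φ ⟪x, e3⟫) (deriv φ (height f p) • innerSL ℝ e3)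
      (f p) :=
    hφ.hasDerivAt.comp_hasFDerivAt (f p) (hlinear ▸ (innerSL ℝ e3).hasFDerivAt)
  rw [hmin p, inner_gradient_left, hderiv.fderiv, angle, real_inner_comm]
  rfl

theorem contMDiff_inner_const {g : M → E3} (hg : ContMDiff (𝓡 2) (𝓡 3) ∞ g) (c : E3) :
    ContMDiff (𝓡 2) 𝓘(ℝ, ℝ) ∞ fun p => ⟪g p, c⟫ :=
  ContDiff.comp_contMDiff (g := fun x : E3 => ⟪x, c⟫) (contDiff_id.inner ℝ contDiff_const) hg

/-- The integrand of the weak form, tested against `ψ`, of the equation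
`div(e^φ ∇η) + e^φ (|𝒮|² + φ'' |∇μ|²) η = 0` satisfied by the angle function of a
`[φ, e₃]`-minimal surface. -/
def weakAngleIntegrand (φ : ℝ → ℝ) (f N : M → E3) (ψ : M → ℝ) (p : M) : ℝ :=
  Real.exp (φ (height f p)) *
    (metric f p (surfaceGradient f ψ p) (surfaceGradient f (angle N) p) -
      (normSqSecondForm f N p + deriv (deriv φ) (height f p) *
        metric f p (surfaceGradient f (height f) p) (surfaceGradient f (height f) p)) *
          angle N p * ψ p)

theorem diffFun_meanCurvature (hμ : MDifferentiableAt (𝓡 2) 𝓘(ℝ, ℝ) (height f) p)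
    (hη : MDifferentiableAt (𝓡 2) 𝓘(ℝ, ℝ) (angle N) p)
    (hφ : DifferentiableAt ℝ (deriv φ) (height f p))
    (hH : ∀ q, meanCurvature f N q = -(deriv φ (height f q) * angle N q))
    (v : TangentSpace (𝓡 2) p) : diffFun (meanCurvature f N) p v =
      -(deriv (deriv φ) (height f p) * angle N p * diffFun (height f) p v +
        deriv φ (height f p) * diffFun (angle N) p v) := by
  have hHeq : meanCurvature f N = fun q => -deriv φ (height f q) * angle N q := funext fun q => by
    rw [hH q, neg_mul]
  have hφμ : MDifferentiableAt (𝓡 2) 𝓘(ℝ, ℝ) (fun q => -deriv φ (height f q)) p :=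
    hφ.neg.comp_mdifferentiableAt hμ
  rw [hHeq, diffFun_mul hφμ hη, diffFun_comp (χ := fun t => -deriv φ t) hφ.neg hμ, deriv.fun_neg]
  ring

theorem diffFun_eq_zero_of_isLocalMin [IsManifold (𝓡 2) ∞ M] {u : M → ℝ}
    (hu : MDifferentiableAt (𝓡 2) 𝓘(ℝ, ℝ) u p) (hmin : IsLocalMin u p) : diffFun u p = 0 := by
  obtain ⟨e, he, y, hy, rfl⟩ := exists_chart_symm_eq p
  have hmin' : IsLocalMin (u ∘ e.symm) y := hmin.comp_tendsto (e.symm.continuousAt hy)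
  ext v
  obtain ⟨a, rfl⟩ := (coordVec_bijective he hy).2 v
  exact (mfderiv_coordVec he hu hy a).trans (DFunLike.congr_fun hmin'.fderiv_eq_zero a)

namespace IsOrientedImmersion

variable (hf : IsOrientedImmersion f N)
include hf

theorem diffFun_surfaceGradient_comm (u w : M → ℝ) :
    diffFun u p (surfaceGradient f w p) = diffFun w p (surfaceGradient f u p) :=
  (hf.metric_surfaceGradient_left p u _).symm.trans (hf.metric_surfaceGradient_right p w _)

theorem gaussCurvature_eq_zero_of_angle_eq_zero (hη : angle N p = 0)
    (hdη : diffFun (angle N) p = 0) : gaussCurvature f N p = 0 := by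
  have hN := hf.smooth_normal.mdifferentiableAt (x := p) (by simp)
  have hvertical (v : TangentSpace (𝓡 2) p) : ⟪diff N p v, e3⟫ = 0 :=
    (diffFun_inner_const hN e3 v).symm.trans (DFunLike.congr_fun hdη v)
  have hdet := hf.cross_diff_normal_diff_normal p (tangentBasis p 0) (tangentBasis p 1)
  have harea : areaForm f N p (tangentBasis p 0) (tangentBasis p 1) ≠ 0 := by
    refine hf.areaForm_ne_zero p ?_
    convert (tangentBasis p).linearIndependent using 1
    ext i
    fin_cases i <;> rfl
  have hzero : ⟪cross (diff N p (tangentBasis p 0)) (diff N p (tangentBasis p 1)), N p⟫ = 0 := by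
    rw [cross_eq_inner_smul (by simp [e3]) (hvertical _) (hvertical _), real_inner_smul_left]
    exact mul_eq_zero_of_right _ ((real_inner_comm _ _).trans hη)
  rw [hdet, real_inner_smul_left] at hzero
  exact (mul_eq_zero.1 hzero).resolve_right harea

theorem normSqSecondForm_eq_zero_of_isLocalMin_angle [IsManifold (𝓡 2) ∞ M]
    (hmin : IsLocalMin (angle N) p) (hη : angle N p = 0) (hH : meanCurvature f N p = 0) :
    normSqSecondForm f N p = 0 := by
  have hdη := diffFun_eq_zero_of_isLocalMin
    ((contMDiff_inner_const hf.smooth_normal e3).mdifferentiableAt (by simp)) hmin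
  rw [normSqSecondForm, hH, hf.gaussCurvature_eq_zero_of_angle_eq_zero hη hdη]
  norm_num

theorem metric_surfaceGradient_mul {ζ w : M → ℝ} (hζ : MDifferentiableAt (𝓡 2) 𝓘(ℝ, ℝ) ζ p)
    (hw : MDifferentiableAt (𝓡 2) 𝓘(ℝ, ℝ) w p) :
    metric f p (surfaceGradient f (fun q => ζ q * w q) p)
        (surfaceGradient f (fun q => ζ q * w q) p) =
      metric f p (surfaceGradient f (fun q => ζ q * (ζ q * w q)) p) (surfaceGradient f w p) +
        w p ^ 2 * metric f p (surfaceGradient f ζ p) (surfaceGradient f ζ p) := by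
  have hζw : MDifferentiableAt (𝓡 2) 𝓘(ℝ, ℝ) (fun q => ζ q * w q) p := hζ.mul hw
  simp only [hf.metric_surfaceGradient_left, diffFun_mul hζ hζw, diffFun_mul hζ hw,
    hf.diffFun_surfaceGradient_comm _ (fun q => ζ q * w q)]
  rw [hf.diffFun_surfaceGradient_comm w ζ]
  ring

theorem inner_divSmulGradNormal_e3 (hφ : ContDiffAt ℝ ∞ φ (height f p))
    (hH : ∀ q, meanCurvature f N q = -(deriv φ (height f q) * angle N q)) {ψ : M → ℝ}
    (hψ : MDifferentiableAt (𝓡 2) 𝓘(ℝ, ℝ) ψ p) :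
    ⟪divSmulGradNormal f N (fun q => Real.exp (φ (height f q)) * ψ q) p, e3⟫ =
      weakAngleIntegrand φ f N ψ p := by
  have hμ : MDifferentiableAt (𝓡 2) 𝓘(ℝ, ℝ) (height f) p :=
    (contMDiff_inner_const hf.smooth e3).mdifferentiableAt (by simp)
  have hη : MDifferentiableAt (𝓡 2) 𝓘(ℝ, ℝ) (angle N) p :=
    (contMDiff_inner_const hf.smooth_normal e3).mdifferentiableAt (by simp)
  have hφd := hφ.differentiableAt (by simp)
  have hexp : DifferentiableAt ℝ (fun t => Real.exp (φ t)) (height f p) := hφd.exp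
  have hexpμ : MDifferentiableAt (𝓡 2) 𝓘(ℝ, ℝ) (fun q => Real.exp (φ (height f q))) p :=
    hexp.comp_mdifferentiableAt hμ
  have hweight (v : TangentSpace (𝓡 2) p) :
      diffFun (fun q => Real.exp (φ (height f q)) * ψ q) p v = Real.exp (φ (height f p)) *
        (diffFun ψ p v + ψ p * deriv φ (height f p) * diffFun (height f) p v) := by
    rw [diffFun_mul hexpμ hψ,
      diffFun_comp (χ := fun t => Real.exp (φ t)) hexp hμ, hφd.hasDerivAt.exp.deriv]
    ring
  have hdη (v : TangentSpace (𝓡 2) p) : ⟪diff N p v, e3⟫ = diffFun (angle N) p v :=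
    (diffFun_inner_const (hf.smooth_normal.mdifferentiableAt (by simp)) e3 v).symm
  have hdμ (v : TangentSpace (𝓡 2) p) : ⟪diff f p v, e3⟫ = diffFun (height f) p v :=
    (diffFun_inner_const (hf.smooth.mdifferentiableAt (by simp)) e3 v).symm
  have hφ'd : DifferentiableAt ℝ (deriv φ) (height f p) :=
    (contDiffAt_deriv hφ).differentiableAt (by simp)
  rw [divSmulGradNormal, inner_add_left, real_inner_smul_left, inner_sub_left,
    real_inner_smul_left, hdη, hdμ, hf.diffFun_surfaceGradient_comm (angle N),
    hf.diffFun_surfaceGradient_comm (height f), hweight,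
    diffFun_meanCurvature hμ hη hφ'd hH, weakAngleIntegrand,
    hf.metric_surfaceGradient_left, hf.metric_surfaceGradient_left,
    hf.diffFun_surfaceGradient_comm (angle N) (height f), ← angle]
  ring

end IsOrientedImmersion
end Stability

section SecondVariation

open MeasureTheory

variable {M : Type*} [TopologicalSpace M] [ChartedSpace E2 M] {φ : ℝ → ℝ} {f N : M → E3}
  {u ψ : M → ℝ}

theorem contMDiff_exp_height (hf : ContMDiff (𝓡 2) (𝓡 3) ∞ f)
    (hφ : ∀ p, ContDiffAt ℝ ∞ φ (height f p)) :
    ContMDiff (𝓡 2) 𝓘(ℝ, ℝ) ∞ fun p => Real.exp (φ (height f p)) := fun p =>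
  ContDiffAt.comp_contMDiffAt (g := fun t => Real.exp (φ t)) (hφ p).exp
    (contMDiff_inner_const hf e3 p)

theorem stabilityIntegrand_eq_zero_of_notMem_tsupport {p : M} (hp : p ∉ tsupport u) :
    stabilityIntegrand φ f N u u p = 0 := by
  simp only [stabilityIntegrand, metric, surfaceGradient_eq_zero_of_notMem_tsupport hp,
    image_eq_zero_of_notMem_tsupport hp, map_zero, inner_zero_left, mul_zero, sub_zero]

namespace IsOrientedImmersion

variable (hf : IsOrientedImmersion f N)
include hf

theorem metric_surfaceGradient_div_mul_le {w : M → ℝ} (hu : ContMDiff (𝓡 2) 𝓘(ℝ, ℝ) ∞ u)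
    (hw : ContMDiff (𝓡 2) 𝓘(ℝ, ℝ) ∞ w) (hw0 : ∀ p, w p ≠ 0) (p : M) :
    metric f p (surfaceGradient f (fun q => u q / w q * u q) p) (surfaceGradient f w p) ≤
      metric f p (surfaceGradient f u p) (surfaceGradient f u p) := by
  have hquot : ContMDiff (𝓡 2) 𝓘(ℝ, ℝ) ∞ fun q => u q / w q := hu.div₀ hw hw0
  have heq : (fun q => u q / w q * w q) = u := funext fun q => div_mul_cancel₀ (u q) (hw0 q)
  have hmul := hf.metric_surfaceGradient_mul (hquot.mdifferentiableAt (x := p) (by simp))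
    (hw.mdifferentiableAt (by simp))
  have hsquare : (fun q => u q / w q * (u q / w q * w q)) = fun q => u q / w q * u q :=
    funext fun q => by rw [congrFun heq q]
  rw [heq, hsquare] at hmul
  rw [hmul]
  exact le_add_of_nonneg_right (mul_nonneg (sq_nonneg _) real_inner_self_nonneg)

theorem surfaceGradient_angle_add_const (c : ℝ) (p : M) :
    surfaceGradient f (fun q => angle N q + c) p = surfaceGradient f (angle N) p := by
  have hη := (contMDiff_inner_const hf.smooth_normal e3).mdifferentiableAt (x := p) (by simp)
  have hconst : surfaceGradient f (fun _ => c) p = 0 := surfaceGradient_eq_zero mfderiv_const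
  exact (surfaceGradient_add f hη mdifferentiableAt_const).trans (by rw [hconst, add_zero]; rfl)

theorem weakAngleIntegrand_sub_le_stabilityIntegrand {p : M}
    (hφ'' : 0 ≤ deriv (deriv φ) (height f p)) (hη : ∀ q, 0 ≤ angle N q)
    (hu : ContMDiff (𝓡 2) 𝓘(ℝ, ℝ) ∞ u) {ε : ℝ} (hε : 0 < ε) :
    weakAngleIntegrand φ f N (fun q => u q / (angle N q + ε) * u q) p -
        Real.exp (φ (height f p)) * u p ^ 2 * normSqSecondForm f N p * (ε / (angle N p + ε)) ≤
      stabilityIntegrand φ f N u u p := by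
  have hpos (q : M) : 0 < angle N q + ε := add_pos_of_nonneg_of_pos (hη q) hε
  have hηs : ContMDiff (𝓡 2) 𝓘(ℝ, ℝ) ∞ fun q => angle N q + ε :=
    (contMDiff_inner_const hf.smooth_normal e3).add contMDiff_const
  have hgrad := hf.metric_surfaceGradient_div_mul_le hu hηs (fun q => (hpos q).ne') p
  replace hgrad := (congrArg (metric f p _)
    (hf.surfaceGradient_angle_add_const ε p)).symm.trans_le hgrad
  rw [weakAngleIntegrand, stabilityIntegrand]
  set G := metric f p (surfaceGradient f (height f) p) (surfaceGradient f (height f) p)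
  have hG : 0 ≤ G := real_inner_self_nonneg
  have hquot : angle N p * (u p / (angle N p + ε) * u p) =
      u p ^ 2 * (1 - ε / (angle N p + ε)) := by
    have := (hpos p).ne'
    field_simp
    ring
  have hnonneg : 0 ≤ deriv (deriv φ) (height f p) * (G * (angle N p *
      (u p / (angle N p + ε) * u p)) + angle N p ^ 2 * u p ^ 2) := by
    have : 0 ≤ angle N p * (u p / (angle N p + ε) * u p) := by
      rw [div_mul_eq_mul_div]
      exact mul_nonneg (hη p) (div_nonneg (mul_self_nonneg _) (hpos p).le)
    positivity
  refine sub_nonneg.1 ((mul_nonneg (Real.exp_pos (φ (height f p))).le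
    (add_nonneg (sub_nonneg.2 hgrad) hnonneg)).trans_eq ?_)
  linear_combination -(Real.exp (φ (height f p)) * normSqSecondForm f N p) * hquot

variable [IsManifold (𝓡 2) ∞ M]

theorem continuous_stabilityIntegrand (hφ : ∀ p, ContDiffAt ℝ ∞ φ (height f p))
    (hu : ContMDiff (𝓡 2) 𝓘(ℝ, ℝ) ∞ u) : Continuous (stabilityIntegrand φ f N u u) := by
  have hφ'' : Continuous fun p => deriv (deriv φ) (height f p) :=
    continuous_iff_continuousAt.2 fun p => ContinuousAt.comp (f := height f)
      (contDiffAt_deriv (contDiffAt_deriv (hφ p))).continuousAt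
      (contMDiff_inner_const hf.smooth e3).continuous.continuousAt
  have hη : Continuous (angle N) := (contMDiff_inner_const hf.smooth_normal e3).continuous
  exact (contMDiff_exp_height hf.smooth hφ).continuous.mul
    ((hf.continuous_metric_surfaceGradient hu hu).sub
      ((hf.contMDiff_normSqSecondForm.continuous.sub (hφ''.mul (hη.pow 2))).mul
        (hu.continuous.mul hu.continuous)))

variable [MeasurableSpace M] [BorelSpace M]

theorem integrable_of_continuous_of_eq_zero {h : M → ℝ} (hh : Continuous h)
    (hc : HasCompactSupport u) (h0 : ∀ p ∉ tsupport u, h p = 0) : Integrable h (area f) :=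
  have := isLocallyFiniteMeasure_area hf.smooth
  hh.integrable_of_hasCompactSupport (HasCompactSupport.intro' hc (isClosed_tsupport u) h0)

theorem integrable_stabilityIntegrand (hφ : ∀ p, ContDiffAt ℝ ∞ φ (height f p))
    (hu : ContMDiff (𝓡 2) 𝓘(ℝ, ℝ) ∞ u) (hc : HasCompactSupport u) :
    Integrable (stabilityIntegrand φ f N u u) (area f) :=
  hf.integrable_of_continuous_of_eq_zero (hf.continuous_stabilityIntegrand hφ hu) hc
    fun _ => stabilityIntegrand_eq_zero_of_notMem_tsupport

theorem integrable_exp_mul_sq_mul_normSqSecondForm (hφ : ∀ p, ContDiffAt ℝ ∞ φ (height f p))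
    (hu : ContMDiff (𝓡 2) 𝓘(ℝ, ℝ) ∞ u) (hc : HasCompactSupport u) :
    Integrable (fun p => Real.exp (φ (height f p)) * u p ^ 2 * normSqSecondForm f N p)
      (area f) :=
  hf.integrable_of_continuous_of_eq_zero
    (((contMDiff_exp_height hf.smooth hφ).continuous.mul (hu.continuous.pow 2)).mul
      hf.contMDiff_normSqSecondForm.continuous) hc
    fun p hp => by simp [image_eq_zero_of_notMem_tsupport hp]

variable [T2Space M]

theorem integrable_weakAngleIntegrand (hφ : ∀ p, ContDiffAt ℝ ∞ φ (height f p))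
    (hH : ∀ p, meanCurvature f N p = -(deriv φ (height f p) * angle N p))
    (hψ : ContMDiff (𝓡 2) 𝓘(ℝ, ℝ) ∞ ψ) (hc : HasCompactSupport ψ) :
    Integrable (weakAngleIntegrand φ f N ψ) (area f) :=
  ((hf.integrable_divSmulGradNormal ((contMDiff_exp_height hf.smooth hφ).mul hψ)
    hc.mul_left).inner_const e3).congr (Filter.Eventually.of_forall fun p =>
      hf.inner_divSmulGradNormal_e3 (hφ p) hH (hψ.mdifferentiableAt (by simp)))

theorem integral_weakAngleIntegrand [SecondCountableTopology M]
    (hφ : ∀ p, ContDiffAt ℝ ∞ φ (height f p))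
    (hH : ∀ p, meanCurvature f N p = -(deriv φ (height f p) * angle N p))
    (hψ : ContMDiff (𝓡 2) 𝓘(ℝ, ℝ) ∞ ψ) (hc : HasCompactSupport ψ) :
    ∫ p, weakAngleIntegrand φ f N ψ p ∂area f = 0 := by
  have hw : ContMDiff (𝓡 2) 𝓘(ℝ, ℝ) ∞ fun p => Real.exp (φ (height f p)) * ψ p :=
    (contMDiff_exp_height hf.smooth hφ).mul hψ
  have hwc : HasCompactSupport fun p => Real.exp (φ (height f p)) * ψ p := hc.mul_left
  calc ∫ p, weakAngleIntegrand φ f N ψ p ∂area f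
      = ∫ p, ⟪e3, divSmulGradNormal f N (fun q => Real.exp (φ (height f q)) * ψ q) p⟫
          ∂area f := integral_congr_ae (Filter.Eventually.of_forall fun p =>
        (hf.inner_divSmulGradNormal_e3 (hφ p) hH (hψ.mdifferentiableAt (by simp))).symm.trans
          (real_inner_comm _ _))
    _ = ⟪e3, 0⟫ := by
      rw [integral_inner (hf.integrable_divSmulGradNormal hw hwc) e3,
        hf.integral_divSmulGradNormal hw hwc]
    _ = 0 := inner_zero_right e3

variable [SecondCountableTopology M]

theorem neg_integral_le_stabilityForm (hφ : ∀ p, ContDiffAt ℝ ∞ φ (height f p))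
    (hφ'' : ∀ p, 0 ≤ deriv (deriv φ) (height f p))
    (hH : ∀ p, meanCurvature f N p = -(deriv φ (height f p) * angle N p))
    (hη : ∀ p, 0 ≤ angle N p) (hu : ContMDiff (𝓡 2) 𝓘(ℝ, ℝ) ∞ u) (hc : HasCompactSupport u)
    {ε : ℝ} (hε : 0 < ε) :
    -∫ p, Real.exp (φ (height f p)) * u p ^ 2 * normSqSecondForm f N p *
      (ε / (angle N p + ε)) ∂area f ≤ stabilityForm φ f N u u := by
  have hηs : ContMDiff (𝓡 2) 𝓘(ℝ, ℝ) ∞ fun p => angle N p + ε :=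
    (contMDiff_inner_const hf.smooth_normal e3).add contMDiff_const
  have hη0 (p : M) : angle N p + ε ≠ 0 := (add_pos_of_nonneg_of_pos (hη p) hε).ne'
  have hψ : ContMDiff (𝓡 2) 𝓘(ℝ, ℝ) ∞ fun p => u p / (angle N p + ε) * u p :=
    (hu.div₀ hηs hη0).mul hu
  have hψc : HasCompactSupport fun p => u p / (angle N p + ε) * u p := hc.mul_left
  have hweak := hf.integrable_weakAngleIntegrand hφ hH hψ hψc
  have herror : Integrable (fun p => Real.exp (φ (height f p)) * u p ^ 2 *
      normSqSecondForm f N p * (ε / (angle N p + ε))) (area f) :=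
    hf.integrable_of_continuous_of_eq_zero
      ((((contMDiff_exp_height hf.smooth hφ).continuous.mul (hu.continuous.pow 2)).mul
        hf.contMDiff_normSqSecondForm.continuous).mul
          (continuous_const.div hηs.continuous hη0)) hc
      fun p hp => by simp [image_eq_zero_of_notMem_tsupport hp]
  have hmono := integral_mono (hweak.sub herror) (hf.integrable_stabilityIntegrand hφ hu hc)
    fun p => hf.weakAngleIntegrand_sub_le_stabilityIntegrand (hφ'' p) hη hu hε
  rwa [integral_sub' hweak herror, hf.integral_weakAngleIntegrand hφ hH hψ hψc,
    zero_sub] at hmono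

theorem isStable_of_angle_nonneg (hφ : ∀ p, ContDiffAt ℝ ∞ φ (height f p))
    (hφ'' : ∀ p, 0 ≤ deriv (deriv φ) (height f p))
    (hH : ∀ p, meanCurvature f N p = -(deriv φ (height f p) * angle N p))
    (hη : ∀ p, 0 ≤ angle N p) : IsStable φ f N := by
  intro u hu hc
  refine ⟨hf.integrable_stabilityIntegrand hφ hu hc, ?_⟩
  have hzero (p : M) (hp : angle N p = 0) :
      Real.exp (φ (height f p)) * u p ^ 2 * normSqSecondForm f N p = 0 := by
    have hmin : IsLocalMin (angle N) p :=
      Filter.Eventually.of_forall fun q => hp.trans_le (hη q)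
    rw [hf.normSqSecondForm_eq_zero_of_isLocalMin_angle hmin hp
      (by rw [hH, hp, mul_zero, neg_zero]), mul_zero]
  have hlimit := (tendsto_integral_mul_div_add
    (hf.integrable_exp_mul_sq_mul_normSqSecondForm hφ hu hc)
    (contMDiff_inner_const hf.smooth_normal e3).continuous.aemeasurable hη hzero).neg
  rw [neg_zero] at hlimit
  refine le_of_tendsto hlimit ?_
  filter_upwards [self_mem_nhdsWithin] with ε hε
  exact hf.neg_integral_le_stabilityForm hφ hφ'' hH hη hu hc hε

end IsOrientedImmersion
end SecondVariation

end PhiMinimal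

end

theorem mainTheorem5
    {M : Type*} [TopologicalSpace M] [ChartedSpace PhiMinimal.E2 M] [IsManifold (𝓡 2) ∞ M]
    [T2Space M] [SecondCountableTopology M] [MeasurableSpace M] [BorelSpace M]
    (α : WithBot ℝ) (φ : ℝ → ℝ)
    (hφ : ContDiffOn ℝ ∞ φ {z : ℝ | α < (z : WithBot ℝ)})
    (hφ' : ∀ z : ℝ, α < (z : WithBot ℝ) → 0 < deriv φ z)
    (hφ'' : ∀ z : ℝ, α < (z : WithBot ℝ) → 0 ≤ deriv (deriv φ) z)
    (f N : M → PhiMinimal.E3)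
    (hf : PhiMinimal.IsOrientedImmersion f N)
    (hα : ∀ p, f p ∈ PhiMinimal.upperRegion α)
    (hmin : PhiMinimal.IsPhiMinimal φ f N)
    (hH : ∀ p, PhiMinimal.meanCurvature f N p ≤ 0) :
    PhiMinimal.IsStable φ f N := by
  have hφs (p : M) : ContDiffAt ℝ ∞ φ (PhiMinimal.height f p) :=
    hφ.contDiffAt ((PhiMinimal.isOpen_coe_gt α).mem_nhds (hα p))
  have hHm (p : M) := hmin.meanCurvature_eq_neg ((hφs p).differentiableAt (by simp))
  refine hf.isStable_of_angle_nonneg hφs (fun p => hφ'' _ (hα p)) hHm fun p => ?_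
  have hHp := hH p
  rw [hHm p, neg_nonpos] at hHp
  exact nonneg_of_mul_nonneg_right hHp (hφ' _ (hα p))
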